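/- A hypergraph consists of a finite vertex set $V(H)$ and a set $E(H)$ of distinct non-empty subsets of $V(H)$, called edges (loops, i.e. edges of size one, and edges of different sizes are allowed). Write $F\subseteq H$ if $V(F)\subseteq V(H)$ and $E(F)\subseteq E(H)$, and $F\simeq H$ if $F$ and $H$ are isomorphic. For $n\in\mathbb N$ and $p\in(0,1)$ let $\mathbb H(n,p)$ be the random hypergraph with vertex set $[n]=\{1,\dots,n\}$ in which every non-empty subset of $[n]$ is an edge with probability $p$, independently of all the others. Let $K_n^*$ be the complete hypergraph, with vertex set $[n]$ and all non-empty subsets of $[n]$ as edges. For a hypergraph $H$ let $$Z_H^n=\bigl|\{H'\subseteq K_n^* : H'\simeq H,\ H'\subseteq \mathbb H(n,p)\}\bigr|,\qquad \widetilde Z_H^n=\frac{Z_H^n-\mathbb E[Z_H^n]}{\sqrt{\operatorname{Var}[Z_H^n]}} .$$ **Theorem.** Let $H$ be a fixed hypergraph with at least one edge, and let $m=\min\{|e| : e\in E(H)\}$. There exist $\varepsilon>0$, $C_1,C_2>0$ and $n_0\in\mathbb N$, depending only on $H$, such that for all $n\ge n_0$ and all $p\in(0,1)$ with $p>1-\varepsilon$,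 $$\frac{C_1}{(1-p)\,n^{m}}\ \le\ \mathbb E\bigl[(\widetilde Z_H^n)^4\bigr]-3\ \le\ \frac{C_2}{(1-p)\,n^{m}} .$$ -/

import Mathlib

open MeasureTheory ProbabilityTheory
open scoped Hypergraph

namespace RandomHypergraph

/-- `F ⊆ H`: (not necessarily induced) inclusion of hypergraphs. -/
def IsSubhypergraph {α : Type*} (F H : Hypergraph α) : Prop :=
  V(F) ⊆ V(H) ∧ E(F) ⊆ E(H)

/-- `F ≃ H`: there is a bijection between the vertex sets under which a set of vertices is an edge
of `F` if and only if its image is an edge of `H`. -/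
def IsIsomorphic {α β : Type*} (F : Hypergraph α) (H : Hypergraph β) : Prop :=
  ∃ f : V(F) ≃ V(H), ∀ s : Set V(F),
    (Subtype.val '' s : Set α) ∈ E(F) ↔ (Subtype.val '' (f '' s) : Set β) ∈ E(H)

/-- The hypergraph on the full vertex set `α` with a given set of edges. -/
def ofEdges {α : Type*} (S : Set (Set α)) : Hypergraph α where
  vertexSet := Set.univ
  edgeSet := S
  subset_vertexSet_of_mem_edgeSet' := fun _ _ => Set.subset_univ _

/-- The complete hypergraph `K_n^*` on `n` vertices: its edges are all nonempty sets of vertices. -/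
def completeHypergraph (n : ℕ) : Hypergraph (Fin n) :=
  ofEdges {e | e.Nonempty}

/-- The law of the edge set of the homogeneous random hypergraph `ℍ(n, p)`: every nonempty subset
of the `n` vertices is an edge with probability `p`, independently of the others. -/
noncomputable def edgeLaw (n : ℕ) (p : unitInterval) : Measure (Set (Set (Fin n))) :=
  setBernoulli E(completeHypergraph n) p

/-- The subgraph count `Z_H^n`: the number of hypergraphs `H' ⊆ K_n^*` with `H' ≃ H` which are
contained in the hypergraph on `n` vertices with edge set `S`. -/
noncomputable def copyCount {α : Type*} (H : Hypergraph α) (n : ℕ) (S : Set (Set (Fin n))) : ℝ :=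
  (Set.ncard {H' : Hypergraph (Fin n) | IsSubhypergraph H' (completeHypergraph n) ∧
    IsIsomorphic H' H ∧ IsSubhypergraph H' (ofEdges S)} : ℝ)

/-- The standardization `(X - 𝔼[X]) / √(Var[X])` of a real random variable. -/
noncomputable def standardize {Ω : Type*} [MeasurableSpace Ω] (X : Ω → ℝ) (μ : Measure Ω) :
    Ω → ℝ :=
  fun ω => (X ω - ∫ x, X x ∂μ) / √(variance X μ)

/-- The fourth moment of the standardized count of copies of `H` in `ℍ(n, p)`. -/
noncomputable def fourthMoment {α : Type*} (H : Hypergraph α) (n : ℕ) (p : unitInterval) : ℝ :=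
  ∫ S, (standardize (copyCount H n) (edgeLaw n p) S) ^ 4 ∂(edgeLaw n p)

/-- The smallest size of an edge of `H`. -/
noncomputable def minEdgeSize {α : Type*} (H : Hypergraph α) : ℕ :=
  sInf (Set.ncard '' E(H))

end RandomHypergraph

/-! Counting embeddings instead of copies multiplies $Z_H^n$ by $|\mathrm{Aut}(H)|$, which
standardization removes. Writing every edge indicator as $p+\xi_e$ and expanding, the centred count
becomes $W=\sum_{(\varphi,A)}p^{|E|-|A|}\prod_{e\in A}\xi_{\varphi(e)}$, over embeddings $\varphi$
and nonempty sets $A$ of edges of $H$. Hence $\mathbb E[\widetilde Z^4]-3=\kappa/v^2$, with $v$ the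
variance and $\kappa$ the fourth cumulant of $W$ (`fourthMoment_eq`). With $q=1-p$, $x=n^{|V|}$,
$y=n^m$, the claim follows from $v\asymp qx^2/y$ and $\kappa\asymp qx^4/y^3$ (`exists_sum_bounds`).

Upper bounds: a joint cumulant of four terms vanishes unless their edge sets are connected through
intersections (`isConnected₄_of_cumulant₄_ne_zero`). A given term meets $O(x/y)$ others, since a
shared edge fixes the image of at least $m$ vertices. So there are $O(x(x/y)^3)$ connected
quadruples, each contributing $O(q)$; the variance is treated in the same way with pairs.

Lower bounds: the terms with $A=\{e_0\}$, $|e_0|=m$, number of order $x$ and have at most $y$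
distinct image edges, so the power mean inequality gives enough coincidences, each contributing
order $q$. In $v$ nothing is negative. In $\kappa$ a negative contribution needs at least two
distinct edges and is $O(q^2)$, hence absorbed for small $q$ (`le_fourthCumulantSum`). -/

namespace RandomHypergraph

/-! ### Joint fourth cumulants of products of independent centred variables -/

section Cumulants

variable {ι : Type*} [Fintype ι] [DecidableEq ι]

/-- The mixed second moment `∏ₑ m(kₑ)`, where `kₑ` is the number of sets among `A, B` containing
`e` and `m k` is the `k`-th moment of each of the independent factors. -/
def moment₂ (m : ℕ → ℝ) (A B : Finset ι) : ℝ :=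
  ∏ e, m ((if e ∈ A then 1 else 0) + (if e ∈ B then 1 else 0))

/-- The mixed fourth moment `∏ₑ m(kₑ)`, where `kₑ` is the number of sets among `A, B, C, D`
containing `e`. -/
def moment₄ (m : ℕ → ℝ) (A B C D : Finset ι) : ℝ :=
  ∏ e, m ((if e ∈ A then 1 else 0) + (if e ∈ B then 1 else 0) + (if e ∈ C then 1 else 0)
    + (if e ∈ D then 1 else 0))

/-- The mixed fourth moment minus the three products of mixed second moments. -/
def cumulant₄ (m : ℕ → ℝ) (A B C D : Finset ι) : ℝ :=
  moment₄ m A B C D - moment₂ m A B * moment₂ m C D - moment₂ m A C * moment₂ m B D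
    - moment₂ m A D * moment₂ m B C

lemma moment₂_comm (m : ℕ → ℝ) (A B : Finset ι) : moment₂ m A B = moment₂ m B A := by
  unfold moment₂
  refine Finset.prod_congr rfl fun e _ => congrArg m ?_
  ring

lemma cumulant₄_swap₁₂ (m : ℕ → ℝ) (A B C D : Finset ι) :
    cumulant₄ m A B C D = cumulant₄ m B A C D := by
  have : moment₄ m A B C D = moment₄ m B A C D :=
    Finset.prod_congr rfl fun e _ => congrArg m (by ring)
  unfold cumulant₄
  rw [this, moment₂_comm m A B]
  ring

lemma cumulant₄_swap₂₃ (m : ℕ → ℝ) (A B C D : Finset ι) :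
    cumulant₄ m A B C D = cumulant₄ m A C B D := by
  have : moment₄ m A B C D = moment₄ m A C B D :=
    Finset.prod_congr rfl fun e _ => congrArg m (by ring)
  unfold cumulant₄
  rw [this, moment₂_comm m B C]
  ring

lemma cumulant₄_swap₃₄ (m : ℕ → ℝ) (A B C D : Finset ι) :
    cumulant₄ m A B C D = cumulant₄ m A B D C := by
  have : moment₄ m A B C D = moment₄ m A B D C :=
    Finset.prod_congr rfl fun e _ => congrArg m (by ring)
  unfold cumulant₄
  rw [this, moment₂_comm m C D]
  ring

variable {m : ℕ → ℝ}

lemma moment₂_eq_zero (h1 : m 1 = 0) {A B : Finset ι} (hAB : A ≠ B) : moment₂ m A B = 0 := by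
  obtain ⟨e, he⟩ : ∃ e, ¬(e ∈ A ↔ e ∈ B) := by
    by_contra! h
    exact hAB (Finset.ext h)
  refine Finset.prod_eq_zero (Finset.mem_univ e) ?_
  by_cases hA : e ∈ A <;> by_cases hB : e ∈ B <;> simp_all

lemma moment₂_self (h0 : m 0 = 1) (A : Finset ι) : moment₂ m A A = m 2 ^ A.card := by
  have : ∀ e : ι, m ((if e ∈ A then 1 else 0) + (if e ∈ A then 1 else 0))
      = if e ∈ A then m 2 else 1 := by
    intro e
    split_ifs <;> simp [h0]
  simp [moment₂, this, Finset.prod_ite_mem]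

lemma moment₄_eq_zero (h1 : m 1 = 0) {A B C D : Finset ι} {e : ι} (hA : e ∈ A) (hB : e ∉ B)
    (hC : e ∉ C) (hD : e ∉ D) : moment₄ m A B C D = 0 :=
  Finset.prod_eq_zero (Finset.mem_univ e) (by simp [*])

/-- An index private to one set gives a factor `m 1 = 0` in the fourth moment. It also makes `A`
differ from the other three sets, so every pairing vanishes. -/
lemma cumulant₄_eq_zero (h1 : m 1 = 0) {A B C D : Finset ι} {e : ι} (hA : e ∈ A) (hB : e ∉ B)
    (hC : e ∉ C) (hD : e ∉ D) : cumulant₄ m A B C D = 0 := by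
  have h (X : Finset ι) (hX : e ∉ X) : A ≠ X := by
    rintro rfl
    exact hX hA
  simp [cumulant₄, moment₄_eq_zero h1 hA hB hC hD, moment₂_eq_zero h1 (h B hB),
    moment₂_eq_zero h1 (h C hC), moment₂_eq_zero h1 (h D hD)]

lemma cumulant₄_eq_zero_of_disjoint (h1 : m 1 = 0) {A B C D : Finset ι} (hA : A.Nonempty)
    (hB : Disjoint A B) (hC : Disjoint A C) (hD : Disjoint A D) : cumulant₄ m A B C D = 0 := by
  obtain ⟨e, he⟩ := hA
  exact cumulant₄_eq_zero h1 he (Finset.disjoint_left.1 hB he) (Finset.disjoint_left.1 hC he)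
    (Finset.disjoint_left.1 hD he)

/-- If `A = B` and `C = D`, the fourth moment factors by independence and cancels one pairing, while
the other two vanish because `A ≠ C`. Otherwise an element of one of the symmetric differences is
private to a single set. -/
lemma cumulant₄_eq_zero_of_split (h0 : m 0 = 1) (h1 : m 1 = 0) {A B C D : Finset ι}
    (hA : A.Nonempty) (hAC : Disjoint A C) (hAD : Disjoint A D) (hBC : Disjoint B C)
    (hBD : Disjoint B D) : cumulant₄ m A B C D = 0 := by
  by_cases hAB : A = B
  · by_cases hCD : C = D
    · subst hAB hCD
      have hne : A ≠ C := by
        rintro rfl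
        simp at hAC
        simp [hAC] at hA
      have h4 : moment₄ m A A C C = moment₂ m A A * moment₂ m C C := by
        unfold moment₄ moment₂
        rw [← Finset.prod_mul_distrib]
        refine Finset.prod_congr rfl fun e _ => ?_
        by_cases hA : e ∈ A
        · have := Finset.disjoint_left.1 hAC hA
          simp [hA, this, h0]
        · simp [hA, h0]
      simp [cumulant₄, h4, moment₂_eq_zero h1 hne]
    · obtain ⟨e, he⟩ : ∃ e, ¬(e ∈ C ↔ e ∈ D) := by
        by_contra! h
        exact hCD (Finset.ext h)
      by_cases hC : e ∈ C
      · have hD : e ∉ D := by tauto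
        rw [cumulant₄_swap₂₃, cumulant₄_swap₁₂]
        exact cumulant₄_eq_zero h1 hC (Finset.disjoint_right.1 hAC hC)
          (Finset.disjoint_right.1 hBC hC) hD
      · have hD : e ∈ D := by tauto
        rw [cumulant₄_swap₃₄, cumulant₄_swap₂₃, cumulant₄_swap₁₂]
        exact cumulant₄_eq_zero h1 hD (Finset.disjoint_right.1 hAD hD)
          (Finset.disjoint_right.1 hBD hD) hC
  · obtain ⟨e, he⟩ : ∃ e, ¬(e ∈ A ↔ e ∈ B) := by
      by_contra! h
      exact hAB (Finset.ext h)
    by_cases hA : e ∈ A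
    · exact cumulant₄_eq_zero h1 hA (by tauto) (Finset.disjoint_left.1 hAC hA)
        (Finset.disjoint_left.1 hAD hA)
    · have hB : e ∈ B := by tauto
      rw [cumulant₄_swap₁₂]
      exact cumulant₄_eq_zero h1 hB hA (Finset.disjoint_left.1 hBC hB)
        (Finset.disjoint_left.1 hBD hB)

lemma abs_moment₄_le {q : ℝ} (h0 : m 0 = 1)
    (hm : ∀ k, 1 ≤ k → k ≤ 4 → |m k| ≤ q) (A B C D : Finset ι) :
    |moment₄ m A B C D| ≤ q ^ (A ∪ B ∪ C ∪ D).card := by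
  have hq : 0 ≤ q := (abs_nonneg _).trans (hm 1 le_rfl (by norm_num))
  unfold moment₄
  rw [Finset.abs_prod]
  calc _ ≤ ∏ e, (if e ∈ A ∪ B ∪ C ∪ D then q else 1) := by
        refine Finset.prod_le_prod (fun _ _ => abs_nonneg _) fun e _ => ?_
        by_cases he : e ∈ A ∪ B ∪ C ∪ D
        · rw [if_pos he]
          simp only [Finset.mem_union] at he
          apply hm <;> split_ifs <;> simp_all
        · simp only [Finset.mem_union, not_or] at he
          simp [he, h0]
    _ = _ := by rw [Finset.prod_ite_mem, Finset.univ_inter, Finset.prod_const]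

lemma abs_moment₂_le {q : ℝ} (h0 : m 0 = 1) (hq1 : q ≤ 1)
    (hm : ∀ k, 1 ≤ k → k ≤ 4 → |m k| ≤ q) {A : Finset ι} (hA : A.Nonempty) (B : Finset ι) :
    |moment₂ m A B| ≤ q := by
  have hq : 0 ≤ q := (abs_nonneg _).trans (hm 1 le_rfl (by norm_num))
  -- A second moment is a fourth moment padded with empty sets.
  have := abs_moment₄_le h0 hm A B ∅ ∅
  have h2 : moment₄ m A B ∅ ∅ = moment₂ m A B := by simp [moment₄, moment₂]
  rw [h2] at this
  refine this.trans (pow_le_of_le_one hq hq1 ?_)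
  obtain ⟨e, he⟩ := hA
  exact Finset.card_ne_zero_of_mem (a := e) (by simp [he])

/-- The union's size is kept in the exponent: one element gives order `q`, two or more give order `q
^ 2`, and the lower bound on the cumulant depends on this difference. -/
lemma abs_cumulant₄_le {q : ℝ} (h0 : m 0 = 1) (hq1 : q ≤ 1)
    (hm : ∀ k, 1 ≤ k → k ≤ 4 → |m k| ≤ q) {A B C D : Finset ι} (hA : A.Nonempty)
    (hB : B.Nonempty) (hC : C.Nonempty) :
    |cumulant₄ m A B C D| ≤ q ^ (A ∪ B ∪ C ∪ D).card + 3 * q ^ 2 := by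
  have hq : 0 ≤ q := (abs_nonneg _).trans (hm 1 le_rfl (by norm_num))
  have key {X Y Z W : Finset ι} (hX : X.Nonempty) (hZ : Z.Nonempty) :
      |moment₂ m X Y * moment₂ m Z W| ≤ q ^ 2 := by
    rw [abs_mul, sq]
    exact mul_le_mul (abs_moment₂_le h0 hq1 hm hX _) (abs_moment₂_le h0 hq1 hm hZ _)
      (abs_nonneg _) hq
  have e1 := abs_le.1 (abs_moment₄_le h0 hm A B C D)
  have e2 := abs_le.1 (key (Y := B) (W := D) hA hC)
  have e3 := abs_le.1 (key (Y := C) (W := D) hA hB)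
  have e4 := abs_le.1 (key (Y := D) (W := C) hA hB)
  unfold cumulant₄
  rw [abs_le]
  constructor <;> linarith

lemma cumulant₄_singleton (h0 : m 0 = 1) (e : ι) :
    cumulant₄ m {e} {e} {e} {e} = m 4 - 3 * m 2 ^ 2 := by
  have h4 : moment₄ m {e} {e} {e} {e} = m 4 := by
    unfold moment₄
    rw [Finset.prod_eq_single e]
    · simp
    · intro b _ hb
      simp [hb, h0]
    · simp
  simp only [cumulant₄, h4, moment₂_self h0]
  simp
  ring

/-- The sets `A, B, C, D` in this order form a cluster if each one but the first meets an earlier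
one. -/
def IsCluster (A B C D : Finset ι) : Prop :=
  ¬Disjoint A B ∧ (¬Disjoint A C ∨ ¬Disjoint B C) ∧
    (¬Disjoint A D ∨ ¬Disjoint B D ∨ ¬Disjoint C D)

/-- Some order of the sets starting with `A` is a cluster. -/
def IsConnected₄ (A B C D : Finset ι) : Prop :=
  IsCluster A B C D ∨ IsCluster A B D C ∨ IsCluster A C B D ∨ IsCluster A C D B ∨
    IsCluster A D B C ∨ IsCluster A D C B

/-- A disconnected intersection graph on four vertices has an isolated vertex (four cases) or splits
into two pairs (three cases), and the cumulant vanishes in all seven. -/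
lemma isConnected₄_of_cumulant₄_ne_zero (h0 : m 0 = 1) (h1 : m 1 = 0) {A B C D : Finset ι}
    (hA : A.Nonempty) (hB : B.Nonempty) (hC : C.Nonempty) (hD : D.Nonempty)
    (h : cumulant₄ m A B C D ≠ 0) : IsConnected₄ A B C D := by
  have hB0 : ¬(Disjoint A B ∧ Disjoint B C ∧ Disjoint B D) := fun ⟨x, y, z⟩ => h <| by
    rw [cumulant₄_swap₁₂]
    exact cumulant₄_eq_zero_of_disjoint h1 hB x.symm y z
  have hC0 : ¬(Disjoint A C ∧ Disjoint B C ∧ Disjoint C D) := fun ⟨x, y, z⟩ => h <| by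
    rw [cumulant₄_swap₂₃, cumulant₄_swap₁₂]
    exact cumulant₄_eq_zero_of_disjoint h1 hC x.symm y.symm z
  have hD0 : ¬(Disjoint A D ∧ Disjoint B D ∧ Disjoint C D) := fun ⟨x, y, z⟩ => h <| by
    rw [cumulant₄_swap₃₄, cumulant₄_swap₂₃, cumulant₄_swap₁₂]
    exact cumulant₄_eq_zero_of_disjoint h1 hD x.symm y.symm z.symm
  have hA0 : ¬(Disjoint A B ∧ Disjoint A C ∧ Disjoint A D) := fun ⟨x, y, z⟩ =>
    h <| cumulant₄_eq_zero_of_disjoint h1 hA x y z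
  have s2 : ¬(Disjoint A C ∧ Disjoint A D ∧ Disjoint B C ∧ Disjoint B D) := fun ⟨x, y, z, w⟩ =>
    h <| cumulant₄_eq_zero_of_split h0 h1 hA x y z w
  have s3 : ¬(Disjoint A B ∧ Disjoint A D ∧ Disjoint B C ∧ Disjoint C D) := fun ⟨x, y, z, w⟩ =>
    h <| by
      rw [cumulant₄_swap₂₃]
      exact cumulant₄_eq_zero_of_split h0 h1 hA x y z.symm w
  have s4 : ¬(Disjoint A B ∧ Disjoint A C ∧ Disjoint B D ∧ Disjoint C D) := fun ⟨x, y, z, w⟩ =>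
    h <| by
      rw [cumulant₄_swap₃₄, cumulant₄_swap₂₃]
      exact cumulant₄_eq_zero_of_split h0 h1 hA x y z.symm w.symm
  unfold IsConnected₄ IsCluster
  simp only [disjoint_comm (a := C) (b := B), disjoint_comm (a := D) (b := B),
    disjoint_comm (a := D) (b := C)]
  clear h hA hB hC hD
  -- Only the truth values of the six disjointness relations matter from here on.
  generalize Disjoint A B = a at *
  generalize Disjoint A C = b at *
  generalize Disjoint A D = c at *
  generalize Disjoint B C = d at *
  generalize Disjoint B D = e at *
  generalize Disjoint C D = f at *
  by_cases a <;> by_cases b <;> by_cases c <;> by_cases d <;> by_cases e <;> by_cases f <;> simp_all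

end Cumulants

/-! ### Counting connected quadruples -/

section ClusterCount

variable {ι T : Type*} [DecidableEq ι]

-- The sets are chosen in order: given the first, there are at most `K` choices for the second, `2 *
-- K` for the third and `3 * K` for the fourth, whence the factor 6.
open Classical in
lemma sum_isCluster_le (s : Finset T) (G : T → Finset ι) (K : ℝ)
    (hK : ∀ t ∈ s, (∑ u ∈ s, if ¬Disjoint (G t) (G u) then (1 : ℝ) else 0) ≤ K) :
    (∑ a ∈ s, ∑ b ∈ s, ∑ c ∈ s, ∑ d ∈ s, if IsCluster (G a) (G b) (G c) (G d) then (1 : ℝ) else 0)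
      ≤ 6 * s.card * K ^ 3 := by
  obtain rfl | ⟨t₀, ht₀⟩ := s.eq_empty_or_nonempty
  · simp
  have hK0 : 0 ≤ K := (Finset.sum_nonneg fun _ _ => by positivity).trans (hK t₀ ht₀)
  set R : T → T → ℝ := fun t u => if ¬Disjoint (G t) (G u) then (1 : ℝ) else 0 with hR
  have hR0 : ∀ t u, 0 ≤ R t u := fun t u => by simp only [hR]; positivity
  have h3 : ∀ a ∈ s, ∀ b ∈ s, ∀ c ∈ s,
      (∑ d ∈ s, if IsCluster (G a) (G b) (G c) (G d) then (1 : ℝ) else 0)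
        ≤ R a b * (R a c + R b c) * (3 * K) := by
    intro a ha b hb c hc
    calc _ ≤ ∑ d ∈ s, R a b * (R a c + R b c) * (R a d + R b d + R c d) := by
          refine Finset.sum_le_sum fun d _ => ?_
          split_ifs with h
          · obtain ⟨h1, h2, h3⟩ := h
            have e1 : R a b = 1 := if_pos h1
            have e2 : 1 ≤ R a c + R b c := by
              rcases h2 with h | h
              · linarith [hR0 b c, show R a c = 1 from if_pos h]
              · linarith [hR0 a c, show R b c = 1 from if_pos h]
            have e3 : 1 ≤ R a d + R b d + R c d := by
              rcases h3 with h | h | h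
              · linarith [hR0 b d, hR0 c d, show R a d = 1 from if_pos h]
              · linarith [hR0 a d, hR0 c d, show R b d = 1 from if_pos h]
              · linarith [hR0 a d, hR0 b d, show R c d = 1 from if_pos h]
            rw [e1, one_mul]
            exact one_le_mul_of_one_le_of_one_le e2 e3
          · have := hR0 a b; have := hR0 a c; have := hR0 b c
            have := hR0 a d; have := hR0 b d; have := hR0 c d
            positivity
      _ ≤ _ := by
          rw [← Finset.mul_sum]
          refine mul_le_mul_of_nonneg_left ?_
            (mul_nonneg (hR0 _ _) (add_nonneg (hR0 _ _) (hR0 _ _)))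
          simp only [Finset.sum_add_distrib]
          linarith [hK a ha, hK b hb, hK c hc]
  have h2 : ∀ a ∈ s, ∀ b ∈ s,
      (∑ c ∈ s, ∑ d ∈ s, if IsCluster (G a) (G b) (G c) (G d) then (1 : ℝ) else 0)
        ≤ R a b * (2 * K) * (3 * K) := by
    intro a ha b hb
    refine (Finset.sum_le_sum fun c hc => h3 a ha b hb c hc).trans ?_
    rw [← Finset.sum_mul, ← Finset.mul_sum]
    refine mul_le_mul_of_nonneg_right (mul_le_mul_of_nonneg_left ?_ (hR0 _ _)) (by positivity)
    simp only [Finset.sum_add_distrib]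
    linarith [hK a ha, hK b hb]
  have h1 : ∀ a ∈ s, (∑ b ∈ s, ∑ c ∈ s, ∑ d ∈ s,
      if IsCluster (G a) (G b) (G c) (G d) then (1 : ℝ) else 0) ≤ K * (2 * K) * (3 * K) := by
    intro a ha
    refine (Finset.sum_le_sum fun b hb => h2 a ha b hb).trans ?_
    rw [← Finset.sum_mul, ← Finset.sum_mul]
    have := hK a ha
    gcongr
  refine (Finset.sum_le_sum h1).trans ?_
  rw [Finset.sum_const, nsmul_eq_mul]
  apply le_of_eq
  ring

-- The six orders of the last three sets give equal sums after renaming the summation variables, so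
-- the cluster bound is multiplied by 6.
open Classical in
lemma sum_isConnected₄_le (s : Finset T) (G : T → Finset ι) (K : ℝ)
    (hK : ∀ t ∈ s, (∑ u ∈ s, if ¬Disjoint (G t) (G u) then (1 : ℝ) else 0) ≤ K) :
    (∑ a ∈ s, ∑ b ∈ s, ∑ c ∈ s, ∑ d ∈ s,
      if IsConnected₄ (G a) (G b) (G c) (G d) then (1 : ℝ) else 0) ≤ 36 * s.card * K ^ 3 := by
  set f : T → T → T → T → ℝ := fun a b c d =>
    if IsCluster (G a) (G b) (G c) (G d) then (1 : ℝ) else 0 with hf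
  have hf0 : ∀ a b c d, 0 ≤ f a b c d := fun a b c d => by simp only [hf]; positivity
  have hle : ∀ a b c d, (if IsConnected₄ (G a) (G b) (G c) (G d) then (1 : ℝ) else 0)
      ≤ f a b c d + f a b d c + f a c b d + f a c d b + f a d b c + f a d c b := by
    intro a b c d
    have n1 := hf0 a b c d; have n2 := hf0 a b d c; have n3 := hf0 a c b d
    have n4 := hf0 a c d b; have n5 := hf0 a d b c; have n6 := hf0 a d c b
    split_ifs with h
    · have key : ∀ {x y z : T}, IsCluster (G a) (G x) (G y) (G z) → f a x y z = 1 :=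
        fun h => if_pos h
      rcases h with h | h | h | h | h | h <;> linarith [key h]
    · positivity
  refine (Finset.sum_le_sum fun a _ => Finset.sum_le_sum fun b _ => Finset.sum_le_sum fun c _ =>
    Finset.sum_le_sum fun d _ => hle a b c d).trans ?_
  simp only [Finset.sum_add_distrib]
  have c2 : ∑ a ∈ s, ∑ b ∈ s, ∑ c ∈ s, ∑ d ∈ s, f a b d c
      = ∑ a ∈ s, ∑ b ∈ s, ∑ c ∈ s, ∑ d ∈ s, f a b c d :=
    Finset.sum_congr rfl fun a _ => Finset.sum_congr rfl fun b _ => Finset.sum_comm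
  have c3 : ∑ a ∈ s, ∑ b ∈ s, ∑ c ∈ s, ∑ d ∈ s, f a c b d
      = ∑ a ∈ s, ∑ b ∈ s, ∑ c ∈ s, ∑ d ∈ s, f a b c d :=
    Finset.sum_congr rfl fun a _ => Finset.sum_comm
  have c4 : ∑ a ∈ s, ∑ b ∈ s, ∑ c ∈ s, ∑ d ∈ s, f a c d b
      = ∑ a ∈ s, ∑ b ∈ s, ∑ c ∈ s, ∑ d ∈ s, f a b c d := by
    rw [← c2]
    exact Finset.sum_congr rfl fun a _ => Finset.sum_comm
  have c5 : ∑ a ∈ s, ∑ b ∈ s, ∑ c ∈ s, ∑ d ∈ s, f a d b c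
      = ∑ a ∈ s, ∑ b ∈ s, ∑ c ∈ s, ∑ d ∈ s, f a b c d := by
    rw [← c3]
    exact Finset.sum_congr rfl fun a _ => Finset.sum_congr rfl fun b _ => Finset.sum_comm
  have c6 : ∑ a ∈ s, ∑ b ∈ s, ∑ c ∈ s, ∑ d ∈ s, f a d c b
      = ∑ a ∈ s, ∑ b ∈ s, ∑ c ∈ s, ∑ d ∈ s, f a b c d := by
    rw [← c4]
    exact Finset.sum_congr rfl fun a _ => Finset.sum_congr rfl fun b _ => Finset.sum_comm
  rw [c2, c3, c4, c5, c6]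
  have := sum_isCluster_le s G K hK
  simp only [hf]
  linarith

end ClusterCount

/-! ### Bounds for second moments and fourth cumulants of multilinear polynomials -/

section Bounds

variable {ι T : Type*} [DecidableEq ι]

/-- Power mean inequality for the fibre sizes of `g`, which add up to `s.card` over at most `N`
fibres. -/
lemma pow_card_div_le_sum_card_pow (s : Finset T) (g : T → ι) (N : ℝ)
    (hcard : ((s.image g).card : ℝ) ≤ N) (k : ℕ) :
    (s.card : ℝ) ^ (k + 1) / N ^ k
      ≤ ∑ e ∈ s.image g, ((s.filter fun t => g t = e).card : ℝ) ^ (k + 1) := by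
  obtain rfl | hs := s.eq_empty_or_nonempty
  · simp
  have hpos : (0 : ℝ) < ((s.image g).card : ℝ) := by
    exact_mod_cast Finset.card_pos.2 (hs.image g)
  have h := pow_sum_div_card_le_sum_pow (s := s.image g)
    (f := fun e => ((s.filter fun t => g t = e).card : ℝ)) (fun _ _ => Nat.cast_nonneg _) k
  have hsum : ∑ e ∈ s.image g, ((s.filter fun t => g t = e).card : ℝ) = s.card := by
    exact_mod_cast (Finset.card_eq_sum_card_image g s).symm
  rw [hsum] at h
  refine le_trans ?_ h
  gcongr

lemma sum_ite_eq_eq_sum_card_sq (s : Finset T) (g : T → ι) :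
    ∑ a ∈ s, ∑ b ∈ s, (if g a = g b then (1 : ℝ) else 0)
      = ∑ e ∈ s.image g, ((s.filter fun t => g t = e).card : ℝ) ^ 2 := by
  rw [← Finset.sum_fiberwise_of_maps_to (t := s.image g) (g := g)
    fun a ha => Finset.mem_image_of_mem g ha]
  refine Finset.sum_congr rfl fun e _ => ?_
  rw [Finset.sum_congr rfl (g := fun _ => ((s.filter fun t => g t = e).card : ℝ))]
  · simp [sq]
  · intro a ha
    rw [(Finset.mem_filter.1 ha).2]
    simp [eq_comm]

lemma sum_ite_eq_eq_sum_card_pow_four (s : Finset T) (g : T → ι) :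
    ∑ a ∈ s, ∑ b ∈ s, ∑ x ∈ s, ∑ y ∈ s,
        (if g a = g b ∧ g a = g x ∧ g a = g y then (1 : ℝ) else 0)
      = ∑ e ∈ s.image g, ((s.filter fun t => g t = e).card : ℝ) ^ 4 := by
  rw [← Finset.sum_fiberwise_of_maps_to (t := s.image g) (g := g)
    fun a ha => Finset.mem_image_of_mem g ha]
  refine Finset.sum_congr rfl fun e _ => ?_
  rw [Finset.sum_congr rfl (g := fun _ => ((s.filter fun t => g t = e).card : ℝ) ^ 3)]
  · simp
    ring
  · intro a ha
    rw [(Finset.mem_filter.1 ha).2]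
    have : ∀ b x y, (if e = g b ∧ e = g x ∧ e = g y then (1 : ℝ) else 0)
        = (if g b = e then 1 else 0) * ((if g x = e then 1 else 0)
          * (if g y = e then 1 else 0)) := by
      intro b x y
      simp only [ite_and, eq_comm (a := e)]
      split_ifs <;> simp
    simp only [this, ← Finset.mul_sum, ← Finset.sum_mul]
    simp
    ring

variable [Fintype ι]

/-- The second moment of `∑ₜ c t ∏_{e ∈ G t} ξₑ`. -/
def secondMomentSum (m : ℕ → ℝ) (s : Finset T) (c : T → ℝ) (G : T → Finset ι) : ℝ :=
  ∑ a ∈ s, ∑ b ∈ s, c a * c b * moment₂ m (G a) (G b)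

/-- The fourth cumulant of `∑ₜ c t ∏_{e ∈ G t} ξₑ`. -/
def fourthCumulantSum (m : ℕ → ℝ) (s : Finset T) (c : T → ℝ) (G : T → Finset ι) : ℝ :=
  ∑ a ∈ s, ∑ b ∈ s, ∑ x ∈ s, ∑ y ∈ s,
    c a * c b * c x * c y * cumulant₄ m (G a) (G b) (G x) (G y)

/-- Each of the three pairings sums to the squared second moment once the summations are reordered.
-/
lemma fourthCumulantSum_eq (m : ℕ → ℝ) (s : Finset T) (c : T → ℝ) (G : T → Finset ι) :
    fourthCumulantSum m s c G = (∑ a ∈ s, ∑ b ∈ s, ∑ x ∈ s, ∑ y ∈ s,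
      c a * c b * c x * c y * moment₄ m (G a) (G b) (G x) (G y))
        - 3 * secondMomentSum m s c G ^ 2 := by
  have e1 : secondMomentSum m s c G ^ 2 = ∑ a ∈ s, ∑ b ∈ s, ∑ x ∈ s, ∑ y ∈ s,
      c a * c b * c x * c y * (moment₂ m (G a) (G b) * moment₂ m (G x) (G y)) := by
    rw [sq, secondMomentSum, Finset.sum_mul]
    refine Finset.sum_congr rfl fun a _ => ?_
    rw [Finset.sum_mul]
    refine Finset.sum_congr rfl fun b _ => ?_
    rw [Finset.mul_sum]
    refine Finset.sum_congr rfl fun x _ => ?_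
    rw [Finset.mul_sum]
    exact Finset.sum_congr rfl fun y _ => by ring
  have e2 : secondMomentSum m s c G ^ 2 = ∑ a ∈ s, ∑ b ∈ s, ∑ x ∈ s, ∑ y ∈ s,
      c a * c b * c x * c y * (moment₂ m (G a) (G x) * moment₂ m (G b) (G y)) := by
    rw [e1]
    refine Finset.sum_congr rfl fun a _ => ?_
    rw [Finset.sum_comm]
    exact Finset.sum_congr rfl fun b _ => Finset.sum_congr rfl fun x _ =>
      Finset.sum_congr rfl fun y _ => by ring
  have e3 : secondMomentSum m s c G ^ 2 = ∑ a ∈ s, ∑ b ∈ s, ∑ x ∈ s, ∑ y ∈ s,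
      c a * c b * c x * c y * (moment₂ m (G a) (G y) * moment₂ m (G b) (G x)) := by
    rw [e2]
    refine Finset.sum_congr rfl fun a _ => Finset.sum_congr rfl fun b _ => ?_
    rw [Finset.sum_comm]
    exact Finset.sum_congr rfl fun x _ => Finset.sum_congr rfl fun y _ => by ring
  have : 3 * secondMomentSum m s c G ^ 2 = secondMomentSum m s c G ^ 2
      + secondMomentSum m s c G ^ 2 + secondMomentSum m s c G ^ 2 := by ring
  rw [this]
  nth_rw 1 [e1]
  nth_rw 1 [e2]
  rw [e3]
  simp only [← Finset.sum_add_distrib, ← Finset.sum_sub_distrib, fourthCumulantSum]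
  refine Finset.sum_congr rfl fun a _ => Finset.sum_congr rfl fun b _ =>
    Finset.sum_congr rfl fun x _ => Finset.sum_congr rfl fun y _ => ?_
  unfold cumulant₄
  ring

variable {m : ℕ → ℝ} {s : Finset T} {c : T → ℝ} {G : T → Finset ι} {q K : ℝ}

lemma secondMomentSum_le (h0 : m 0 = 1) (h1 : m 1 = 0) (hq1 : q ≤ 1)
    (hm : ∀ k, 1 ≤ k → k ≤ 4 → |m k| ≤ q) (hc0 : ∀ t ∈ s, 0 ≤ c t) (hc1 : ∀ t ∈ s, c t ≤ 1)
    (hG : ∀ t ∈ s, (G t).Nonempty)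
    (hK : ∀ t ∈ s, (∑ u ∈ s, if ¬Disjoint (G t) (G u) then (1 : ℝ) else 0) ≤ K) :
    secondMomentSum m s c G ≤ q * (s.card * K) := by
  have hq : 0 ≤ q := (abs_nonneg _).trans (hm 1 le_rfl (by norm_num))
  calc secondMomentSum m s c G
      ≤ ∑ a ∈ s, ∑ b ∈ s, q * (if ¬Disjoint (G a) (G b) then (1 : ℝ) else 0) := by
        refine Finset.sum_le_sum fun a ha => Finset.sum_le_sum fun b hb => ?_
        by_cases hd : Disjoint (G a) (G b)
        · have hne : G a ≠ G b := by
            intro h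
            rw [h, disjoint_self] at hd
            exact (hG b hb).ne_empty hd
          simp [hd, moment₂_eq_zero h1 hne]
        · have hab : c a * c b ≤ 1 := mul_le_one₀ (hc1 a ha) (hc0 b hb) (hc1 b hb)
          rw [if_pos hd, mul_one]
          have := abs_moment₂_le h0 hq1 hm (hG a ha) (G b)
          calc c a * c b * moment₂ m (G a) (G b) ≤ c a * c b * q :=
                mul_le_mul_of_nonneg_left ((le_abs_self _).trans this)
                  (mul_nonneg (hc0 a ha) (hc0 b hb))
            _ ≤ q := mul_le_of_le_one_left hq hab
    _ ≤ ∑ a ∈ s, q * K := by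
        refine Finset.sum_le_sum fun a ha => ?_
        rw [← Finset.mul_sum]
        exact mul_le_mul_of_nonneg_left (hK a ha) hq
    _ = q * (s.card * K) := by
        rw [Finset.sum_const, nsmul_eq_mul]
        ring

/-- All mixed second moments are nonnegative, so the sum may be restricted to the single-edge terms
in `s'`, where coincidences of `g` are counted. -/
lemma le_secondMomentSum (h0 : m 0 = 1) (h1 : m 1 = 0) (h2 : 0 ≤ m 2)
    (hc0 : ∀ t ∈ s, 0 ≤ c t) {s' : Finset T} (hs' : s' ⊆ s) {g : T → ι}
    (hg : ∀ t ∈ s', G t = {g t}) {δ : ℝ} (hδ : 0 ≤ δ) (hcδ : ∀ t ∈ s', δ ≤ c t) {N : ℝ}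
    (hcard : ((s'.image g).card : ℝ) ≤ N) :
    m 2 * δ ^ 2 * ((s'.card : ℝ) ^ 2 / N) ≤ secondMomentSum m s c G := by
  have hM : ∀ A B : Finset ι, 0 ≤ moment₂ m A B := by
    intro A B
    by_cases h : A = B
    · rw [h, moment₂_self h0]
      positivity
    · rw [moment₂_eq_zero h1 h]
  have hchain := pow_card_div_le_sum_card_pow s' g N hcard 1
  rw [pow_one, ← sum_ite_eq_eq_sum_card_sq] at hchain
  calc m 2 * δ ^ 2 * ((s'.card : ℝ) ^ 2 / N)
      ≤ m 2 * δ ^ 2 * ∑ a ∈ s', ∑ b ∈ s', (if g a = g b then (1 : ℝ) else 0) :=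
        mul_le_mul_of_nonneg_left hchain (by positivity)
    _ = ∑ a ∈ s', ∑ b ∈ s', m 2 * δ ^ 2 * (if g a = g b then (1 : ℝ) else 0) := by
        simp only [Finset.mul_sum]
    _ ≤ ∑ a ∈ s', ∑ b ∈ s', c a * c b * moment₂ m (G a) (G b) := by
        refine Finset.sum_le_sum fun a ha => Finset.sum_le_sum fun b hb => ?_
        have ca := hc0 a (hs' ha); have cb := hc0 b (hs' hb)
        split_ifs with h
        · rw [hg a ha, hg b hb, h, moment₂_self h0, Finset.card_singleton, pow_one, mul_one,
            mul_comm, sq]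
          gcongr
          exacts [hcδ a ha, hcδ b hb]
        · rw [mul_zero]
          exact mul_nonneg (mul_nonneg ca cb) (hM _ _)
    _ ≤ ∑ a ∈ s', ∑ b ∈ s, c a * c b * moment₂ m (G a) (G b) :=
        Finset.sum_le_sum fun a ha => Finset.sum_le_sum_of_subset_of_nonneg hs' fun b hb _ =>
          mul_nonneg (mul_nonneg (hc0 a (hs' ha)) (hc0 b hb)) (hM _ _)
    _ ≤ secondMomentSum m s c G :=
        Finset.sum_le_sum_of_subset_of_nonneg hs' fun a ha _ => Finset.sum_nonneg fun b hb =>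
          mul_nonneg (mul_nonneg (hc0 a ha) (hc0 b hb)) (hM _ _)

/-- Each connected quadruple contributes at most `4 * q`, and there are at most `36 * s.card * K ^
3` of them. -/
lemma fourthCumulantSum_le (h0 : m 0 = 1) (h1 : m 1 = 0) (hq1 : q ≤ 1)
    (hm : ∀ k, 1 ≤ k → k ≤ 4 → |m k| ≤ q) (hc0 : ∀ t ∈ s, 0 ≤ c t) (hc1 : ∀ t ∈ s, c t ≤ 1)
    (hG : ∀ t ∈ s, (G t).Nonempty)
    (hK : ∀ t ∈ s, (∑ u ∈ s, if ¬Disjoint (G t) (G u) then (1 : ℝ) else 0) ≤ K) :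
    fourthCumulantSum m s c G ≤ 144 * q * (s.card * K ^ 3) := by
  classical
  have hq : 0 ≤ q := (abs_nonneg _).trans (hm 1 le_rfl (by norm_num))
  calc fourthCumulantSum m s c G
      ≤ ∑ a ∈ s, ∑ b ∈ s, ∑ x ∈ s, ∑ y ∈ s, 4 * q *
        (if IsConnected₄ (G a) (G b) (G x) (G y) then (1 : ℝ) else 0) := by
        refine Finset.sum_le_sum fun a ha => Finset.sum_le_sum fun b hb =>
          Finset.sum_le_sum fun x hx => Finset.sum_le_sum fun y hy => ?_
        have ca := hc0 a ha; have cb := hc0 b hb; have cx := hc0 x hx; have cy := hc0 y hy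
        split_ifs with h
        · have hle : c a * c b * c x * c y ≤ 1 :=
            mul_le_one₀ (mul_le_one₀ (mul_le_one₀ (hc1 a ha) cb (hc1 b hb)) cx (hc1 x hx)) cy
              (hc1 y hy)
          have hcum := abs_cumulant₄_le h0 hq1 hm (D := G y) (hG a ha) (hG b hb) (hG x hx)
          have hpow : q ^ (G a ∪ G b ∪ G x ∪ G y).card ≤ q := by
            refine pow_le_of_le_one hq hq1 ?_
            obtain ⟨e, he⟩ := hG a ha
            exact Finset.card_ne_zero_of_mem (a := e) (by simp [he])
          have hsq : q ^ 2 ≤ q := pow_le_of_le_one hq hq1 two_ne_zero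
          calc _ ≤ c a * c b * c x * c y * (4 * q) :=
                mul_le_mul_of_nonneg_left ((le_abs_self _).trans (by linarith)) (by positivity)
            _ ≤ 4 * q := mul_le_of_le_one_left (by positivity) hle
            _ = _ := by ring
        · have : cumulant₄ m (G a) (G b) (G x) (G y) = 0 := by
            by_contra hne
            exact h (isConnected₄_of_cumulant₄_ne_zero h0 h1 (hG a ha) (hG b hb) (hG x hx)
              (hG y hy) hne)
          simp [this]
    _ = 4 * q * ∑ a ∈ s, ∑ b ∈ s, ∑ x ∈ s, ∑ y ∈ s,
        (if IsConnected₄ (G a) (G b) (G x) (G y) then (1 : ℝ) else 0) := by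
        simp only [Finset.mul_sum]
    _ ≤ 4 * q * (36 * s.card * K ^ 3) := by
        refine mul_le_mul_of_nonneg_left (sum_isConnected₄_le s G K fun t ht => ?_)
          (by positivity)
        convert hK t ht
    _ = _ := by ring

/-- The main term comes from quadruples in `s'` with a common edge. Every other quadruple is either
harmless or costs at most `4 * q ^ 2`, and only connected ones cost anything. -/
lemma le_fourthCumulantSum (h0 : m 0 = 1) (h1 : m 1 = 0) (hq1 : q ≤ 1)
    (hm : ∀ k, 1 ≤ k → k ≤ 4 → |m k| ≤ q) (hm4 : 0 ≤ m 4 - 3 * m 2 ^ 2)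
    (hc0 : ∀ t ∈ s, 0 ≤ c t) (hc1 : ∀ t ∈ s, c t ≤ 1) (hG : ∀ t ∈ s, (G t).Nonempty)
    (hK : ∀ t ∈ s, (∑ u ∈ s, if ¬Disjoint (G t) (G u) then (1 : ℝ) else 0) ≤ K)
    {s' : Finset T} (hs' : s' ⊆ s) {g : T → ι}
    (hg : ∀ t ∈ s', G t = {g t}) {δ : ℝ} (hδ : 0 ≤ δ) (hcδ : ∀ t ∈ s', δ ≤ c t) {N : ℝ}
    (hcard : ((s'.image g).card : ℝ) ≤ N) :
    (m 4 - 3 * m 2 ^ 2) * δ ^ 4 * ((s'.card : ℝ) ^ 4 / N ^ 3)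
      - 144 * q ^ 2 * (s.card * K ^ 3) ≤ fourthCumulantSum m s c G := by
  classical
  have hq : 0 ≤ q := (abs_nonneg _).trans (hm 1 le_rfl (by norm_num))
  set r := (m 4 - 3 * m 2 ^ 2) * δ ^ 4 with hr
  have hr0 : 0 ≤ r := by positivity
  set f : T → T → T → T → ℝ := fun a b x y =>
    if a ∈ s' ∧ b ∈ s' ∧ x ∈ s' ∧ y ∈ s' ∧ g a = g b ∧ g a = g x ∧ g a = g y then 1 else 0 with hf
  have hmain : r * ((s'.card : ℝ) ^ 4 / N ^ 3)
      ≤ ∑ a ∈ s, ∑ b ∈ s, ∑ x ∈ s, ∑ y ∈ s, r * f a b x y := by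
    have hchain := pow_card_div_le_sum_card_pow s' g N hcard 3
    rw [← sum_ite_eq_eq_sum_card_pow_four] at hchain
    refine (mul_le_mul_of_nonneg_left hchain hr0).trans ?_
    simp only [Finset.mul_sum]
    have hf0 : ∀ a b x y, 0 ≤ r * f a b x y := fun a b x y => by
      simp only [hf]
      positivity
    calc _ = ∑ a ∈ s', ∑ b ∈ s', ∑ x ∈ s', ∑ y ∈ s', r * f a b x y := by
          refine Finset.sum_congr rfl fun a ha => Finset.sum_congr rfl fun b hb =>
            Finset.sum_congr rfl fun x hx => Finset.sum_congr rfl fun y hy => ?_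
          simp [hf, ha, hb, hx, hy]
      _ ≤ _ := by
          refine (Finset.sum_le_sum fun a _ => ?_).trans
            (Finset.sum_le_sum_of_subset_of_nonneg hs' fun a _ _ => Finset.sum_nonneg fun b _ =>
              Finset.sum_nonneg fun x _ => Finset.sum_nonneg fun y _ => hf0 _ _ _ _)
          refine (Finset.sum_le_sum fun b _ => ?_).trans
            (Finset.sum_le_sum_of_subset_of_nonneg hs' fun b _ _ =>
              Finset.sum_nonneg fun x _ => Finset.sum_nonneg fun y _ => hf0 _ _ _ _)
          refine (Finset.sum_le_sum fun x _ => ?_).trans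
            (Finset.sum_le_sum_of_subset_of_nonneg hs' fun x _ _ =>
              Finset.sum_nonneg fun y _ => hf0 _ _ _ _)
          exact Finset.sum_le_sum_of_subset_of_nonneg hs' fun y _ _ => hf0 _ _ _ _
  have hconn := sum_isConnected₄_le s G K fun t ht => by convert hK t ht
  have hneg : 4 * q ^ 2 * ∑ a ∈ s, ∑ b ∈ s, ∑ x ∈ s, ∑ y ∈ s,
        (if IsConnected₄ (G a) (G b) (G x) (G y) then (1 : ℝ) else 0)
      ≤ 144 * q ^ 2 * (s.card * K ^ 3) := by
    refine (mul_le_mul_of_nonneg_left hconn (by positivity)).trans (le_of_eq ?_)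
    ring
  simp only [Finset.mul_sum] at hneg
  refine (sub_le_sub hmain hneg).trans ?_
  simp only [← Finset.sum_sub_distrib]
  refine Finset.sum_le_sum fun a ha => Finset.sum_le_sum fun b hb =>
    Finset.sum_le_sum fun x hx => Finset.sum_le_sum fun y hy => ?_
  have ca := hc0 a ha; have cb := hc0 b hb; have cx := hc0 x hx; have cy := hc0 y hy
  by_cases h : a ∈ s' ∧ b ∈ s' ∧ x ∈ s' ∧ y ∈ s' ∧ g a = g b ∧ g a = g x ∧ g a = g y
  · have hf1 : f a b x y = 1 := if_pos h
    obtain ⟨ha', hb', hx', hy', hab, hax, hay⟩ := h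
    rw [hf1, hg a ha', hg b hb', hg x hx', hg y hy', ← hab, ← hax, ← hay, cumulant₄_singleton h0]
    have hδ4 : δ ^ 4 ≤ c a * c b * c x * c y := by
      have e1 := hcδ a ha'; have e2 := hcδ b hb'; have e3 := hcδ x hx'; have e4 := hcδ y hy'
      calc δ ^ 4 = δ * δ * δ * δ := by ring
        _ ≤ _ := by gcongr
    have h4 : 0 ≤ 4 * q ^ 2 *
        (if IsConnected₄ ({g a} : Finset ι) {g a} {g a} {g a} then (1 : ℝ) else 0) := by positivity
    have := mul_le_mul_of_nonneg_right hδ4 hm4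
    rw [hr]
    linarith
  · have hf1 : f a b x y = 0 := if_neg h
    rw [hf1, mul_zero, zero_sub]
    by_cases hne : cumulant₄ m (G a) (G b) (G x) (G y) = 0
    · rw [hne, mul_zero]
      exact neg_nonpos.2 (by positivity)
    rw [if_pos (isConnected₄_of_cumulant₄_ne_zero h0 h1 (hG a ha) (hG b hb) (hG x hx) (hG y hy)
      hne), mul_one]
    have hcnn : 0 ≤ c a * c b * c x * c y := by positivity
    -- If the union is one edge, all four sets equal that singleton and the cumulant is nonnegative;
    -- otherwise it is at least `-4 * q ^ 2`.
    rcases lt_or_ge (G a ∪ G b ∪ G x ∪ G y).card 2 with hcd | hcd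
    · obtain ⟨e, he⟩ : ∃ e, G a ∪ G b ∪ G x ∪ G y ⊆ {e} := by
        obtain ⟨e, he⟩ := hG a ha
        have := Finset.card_le_one.1 (Nat.lt_succ_iff.1 hcd)
        exact ⟨e, fun z hz => Finset.mem_singleton.2 (this z hz e (by simp [he]))⟩
      simp only [Finset.union_subset_iff] at he
      rw [(hG a ha).subset_singleton_iff.1 he.1.1.1, (hG b hb).subset_singleton_iff.1 he.1.1.2,
        (hG x hx).subset_singleton_iff.1 he.1.2, (hG y hy).subset_singleton_iff.1 he.2,
        cumulant₄_singleton h0]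
      exact (neg_nonpos.2 (by positivity)).trans (mul_nonneg hcnn hm4)
    · have hle : c a * c b * c x * c y ≤ 1 :=
        mul_le_one₀ (mul_le_one₀ (mul_le_one₀ (hc1 a ha) cb (hc1 b hb)) cx (hc1 x hx)) cy
          (hc1 y hy)
      have hcum := abs_cumulant₄_le h0 hq1 hm (D := G y) (hG a ha) (hG b hb) (hG x hx)
      have hpow : q ^ (G a ∪ G b ∪ G x ∪ G y).card ≤ q ^ 2 := pow_le_pow_of_le_one hq hq1 hcd
      have hD := (abs_le.1 (hcum.trans (add_le_add_left hpow _))).1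
      have hb1 : c a * c b * c x * c y * (4 * q ^ 2) ≤ 4 * q ^ 2 :=
        mul_le_of_le_one_left (by positivity) hle
      have hb2 := mul_le_mul_of_nonneg_left hD hcnn
      linarith

end Bounds

/-! ### Moments of polynomials in centred Bernoulli indicators -/

section Moments

variable {ι : Type*}

open Classical in
/-- The centred indicator of `e ∈ S`, where `e` is present with probability `p`. -/
noncomputable def centered (p : ℝ) (e : ι) (S : Set ι) : ℝ := (if e ∈ S then 1 else 0) - p

/-- The `k`-th central moment of a Bernoulli variable with parameter `p`. -/
def bernoulliMoment (p : ℝ) (k : ℕ) : ℝ := p * (1 - p) ^ k + (1 - p) * (-p) ^ k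

/-- The law is the image of a product measure, so the integral factors. Elements outside `u` are
almost surely absent and their centred indicator is the constant `-p`; the exponent must be 0 there.
-/
lemma integral_prod_centered_pow [Fintype ι] (u : Set ι) (p : unitInterval) (k : ι → ℕ)
    (hk : ∀ e, e ∉ u → k e = 0) :
    ∫ S, ∏ e, centered (p : ℝ) e S ^ k e ∂(setBernoulli u p)
      = ∏ e, bernoulliMoment p (k e) := by
  classical
  rw [setBernoulli_eq_map, integral_map (by fun_prop) (by fun_prop)]
  rw [Measure.infinitePi_eq_pi]
  have := integral_fintype_prod_eq_prod (𝕜 := ℝ)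
    (fun (e : ι) (P : Prop) => ((if P then 1 else 0) - (p : ℝ)) ^ k e)
    (μ := fun i : ι => unitInterval.toNNReal p • Measure.dirac (i ∈ u) +
      unitInterval.toNNReal (unitInterval.symm p) • Measure.dirac False)
  simp only [centered, Set.mem_ofPred_eq]
  convert this using 1
  refine Finset.prod_congr rfl fun e _ => ?_
  rw [integral_add_measure, integral_smul_nnreal_measure, integral_smul_nnreal_measure,
    integral_dirac, integral_dirac]
  · by_cases he : e ∈ u
    · simp [he, bernoulliMoment, NNReal.smul_def]
    · simp [hk e he, bernoulliMoment, NNReal.smul_def]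
  · exact Integrable.of_finite
  · exact Integrable.of_finite

/-- The multilinear polynomial `∑ₜ c t ∏_{e ∈ G t} ξₑ` in the centred edge indicators. -/
noncomputable def centeredPoly {T : Type*} (p : ℝ) (s : Finset T) (c : T → ℝ) (G : T → Finset ι)
    (S : Set ι) : ℝ :=
  ∑ t ∈ s, c t * ∏ e ∈ G t, centered p e S

variable [Fintype ι] [DecidableEq ι]

lemma prod_centered_eq (p : ℝ) (A : Finset ι) (S : Set ι) :
    ∏ e ∈ A, centered p e S = ∏ e, centered p e S ^ (if e ∈ A then 1 else 0) := by
  simp only [pow_ite, pow_one, pow_zero]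
  rw [Finset.prod_ite_mem, Finset.univ_inter]

variable {T : Type*} {u : Set ι} (p : unitInterval) {s : Finset T} (c : T → ℝ)
  {G : T → Finset ι}

lemma integral_centeredPoly (hG : ∀ t ∈ s, (G t).Nonempty) (hu : ∀ t ∈ s, ∀ e ∈ G t, e ∈ u) :
    ∫ S, centeredPoly p s c G S ∂(setBernoulli u p) = 0 := by
  unfold centeredPoly
  rw [integral_finsetSum _ fun _ _ => Integrable.of_finite]
  refine Finset.sum_eq_zero fun t ht => ?_
  simp only [prod_centered_eq]
  rw [integral_const_mul, integral_prod_centered_pow]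
  · obtain ⟨e, he⟩ := hG t ht
    rw [Finset.prod_eq_zero (Finset.mem_univ e), mul_zero]
    simp [he, bernoulliMoment]
    ring
  · intro e he
    exact if_neg fun h => he (hu t ht e h)

lemma integral_centeredPoly_sq (hu : ∀ t ∈ s, ∀ e ∈ G t, e ∈ u) :
    ∫ S, centeredPoly p s c G S ^ 2 ∂(setBernoulli u p)
      = secondMomentSum (bernoulliMoment p) s c G := by
  have hexp : ∀ S, centeredPoly p s c G S ^ 2 = ∑ a ∈ s, ∑ b ∈ s, c a * c b *
      ∏ e, centered (p : ℝ) e S ^ ((if e ∈ G a then 1 else 0) + (if e ∈ G b then 1 else 0)) := by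
    intro S
    simp only [centeredPoly, sq, prod_centered_eq, pow_add, Finset.prod_mul_distrib,
      Finset.sum_mul_sum]
    exact Finset.sum_congr rfl fun a _ => Finset.sum_congr rfl fun b _ => by ring
  simp only [hexp]
  rw [integral_finsetSum _ fun _ _ => Integrable.of_finite]
  refine Finset.sum_congr rfl fun a ha => ?_
  rw [integral_finsetSum _ fun _ _ => Integrable.of_finite]
  refine Finset.sum_congr rfl fun b hb => ?_
  rw [integral_const_mul, integral_prod_centered_pow]
  · rfl
  · intro e he
    have h1 : e ∉ G a := fun h => he (hu a ha e h)
    have h2 : e ∉ G b := fun h => he (hu b hb e h)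
    simp [h1, h2]

lemma integral_centeredPoly_pow_four (hu : ∀ t ∈ s, ∀ e ∈ G t, e ∈ u) :
    ∫ S, centeredPoly p s c G S ^ 4 ∂(setBernoulli u p)
      = fourthCumulantSum (bernoulliMoment p) s c G
        + 3 * secondMomentSum (bernoulliMoment p) s c G ^ 2 := by
  have hexp : ∀ S, centeredPoly p s c G S ^ 4 = ∑ a ∈ s, ∑ b ∈ s, ∑ x ∈ s, ∑ y ∈ s,
      c a * c b * c x * c y *
      ∏ e, centered (p : ℝ) e S ^ ((if e ∈ G a then 1 else 0) + (if e ∈ G b then 1 else 0)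
        + (if e ∈ G x then 1 else 0) + (if e ∈ G y then 1 else 0)) := by
    intro S
    have : centeredPoly p s c G S ^ 4 = centeredPoly p s c G S * (centeredPoly p s c G S
        * (centeredPoly p s c G S * centeredPoly p s c G S)) := by ring
    rw [this]
    simp only [centeredPoly, prod_centered_eq, pow_add, Finset.prod_mul_distrib,
      Finset.mul_sum, Finset.sum_mul]
    exact Finset.sum_congr rfl fun a _ => Finset.sum_congr rfl fun b _ =>
      Finset.sum_congr rfl fun x _ => Finset.sum_congr rfl fun y _ => by ring
  rw [fourthCumulantSum_eq, sub_add_cancel]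
  simp only [hexp]
  rw [integral_finsetSum _ fun _ _ => Integrable.of_finite]
  refine Finset.sum_congr rfl fun a ha => ?_
  rw [integral_finsetSum _ fun _ _ => Integrable.of_finite]
  refine Finset.sum_congr rfl fun b hb => ?_
  rw [integral_finsetSum _ fun _ _ => Integrable.of_finite]
  refine Finset.sum_congr rfl fun x hx => ?_
  rw [integral_finsetSum _ fun _ _ => Integrable.of_finite]
  refine Finset.sum_congr rfl fun y hy => ?_
  rw [integral_const_mul, integral_prod_centered_pow]
  · rfl
  · intro e he
    have h1 : e ∉ G a := fun h => he (hu a ha e h)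
    have h2 : e ∉ G b := fun h => he (hu b hb e h)
    have h3 : e ∉ G x := fun h => he (hu x hx e h)
    have h4 : e ∉ G y := fun h => he (hu y hy e h)
    simp [h1, h2, h3, h4]

end Moments
-- Expansion and estimates for embedding counts
section Embeddings

open Classical in
/-- The number of embeddings of `V` into `Fin n` mapping all the sets in `𝓔` into `S`. -/
noncomputable def embeddingCount {V : Type*} [Fintype V] (𝓔 : Finset (Set V)) (n : ℕ)
    (S : Set (Set (Fin n))) : ℝ :=
  ∑ φ : V ↪ Fin n, ∏ e ∈ 𝓔, if φ '' e ∈ S then 1 else 0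

variable {V : Type*} [Fintype V]

open Classical in
/-- The pairs of an embedding and a nonempty set of edges. -/
noncomputable def terms (𝓔 : Finset (Set V)) (n : ℕ) : Finset ((V ↪ Fin n) × Finset (Set V)) :=
  Finset.univ ×ˢ 𝓔.powerset.erase ∅

open Classical in
/-- The images of the edges of a term. -/
noncomputable def termEdges {n : ℕ} (t : (V ↪ Fin n) × Finset (Set V)) : Finset (Set (Fin n)) :=
  t.2.image fun e => t.1 '' e

/-- The coefficient of a term. -/
def termCoeff {n : ℕ} (p : ℝ) (𝓔 : Finset (Set V)) (t : (V ↪ Fin n) × Finset (Set V)) : ℝ :=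
  p ^ (𝓔.card - t.2.card)

lemma mem_terms {𝓔 : Finset (Set V)} {n : ℕ} {t : (V ↪ Fin n) × Finset (Set V)} :
    t ∈ terms 𝓔 n ↔ t.2 ≠ ∅ ∧ t.2 ⊆ 𝓔 := by
  simp [terms]

-- Expand $\prod_e(\xi_{\varphi(e)}+p)$ over subsets of edges; the empty subset gives the constant
-- term and is therefore excluded from `terms`.
open Classical in
lemma embeddingCount_eq (𝓔 : Finset (Set V)) (n : ℕ) (p : ℝ) (S : Set (Set (Fin n))) :
    embeddingCount 𝓔 n S = Fintype.card (V ↪ Fin n) * p ^ 𝓔.card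
      + centeredPoly p (terms 𝓔 n) (termCoeff p 𝓔) termEdges S := by
  have h1 : ∀ φ : V ↪ Fin n, (∏ e ∈ 𝓔, if φ '' e ∈ S then (1 : ℝ) else 0)
      = p ^ 𝓔.card + ∑ A ∈ 𝓔.powerset.erase ∅,
        termCoeff p 𝓔 (φ, A) * ∏ e ∈ termEdges (φ, A), centered p e S := by
    intro φ
    have h2 : ∀ A ∈ 𝓔.powerset, (∏ e ∈ A, centered p (φ '' e) S) * ∏ _e ∈ 𝓔 \ A, p
        = termCoeff p 𝓔 (φ, A) * ∏ e ∈ termEdges (φ, A), centered p e S := by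
      intro A hA
      rw [termEdges, Finset.prod_image fun a _ b _ h => φ.injective.image_injective h,
        Finset.prod_const, Finset.card_sdiff_of_subset (Finset.mem_powerset.1 hA), termCoeff,
        mul_comm]
    calc (∏ e ∈ 𝓔, if φ '' e ∈ S then (1 : ℝ) else 0)
        = ∏ e ∈ 𝓔, (centered p (φ '' e) S + p) :=
          Finset.prod_congr rfl fun e _ => by simp [centered]
      _ = ∑ A ∈ 𝓔.powerset, termCoeff p 𝓔 (φ, A) * ∏ e ∈ termEdges (φ, A), centered p e S := by
          rw [Finset.prod_add]
          exact Finset.sum_congr rfl h2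
      _ = _ := by
          rw [← Finset.add_sum_erase _ _ (Finset.empty_mem_powerset 𝓔)]
          simp [termCoeff, termEdges]
  simp only [embeddingCount, h1, Finset.sum_add_distrib, centeredPoly, terms]
  rw [Finset.sum_product]
  simp

-- An embedding with `φ '' e = S` is determined by a map from `e` to `S`, of which there are
-- boundedly many, and by its values off `e`, at most `n` for each of the remaining vertices.
open Classical in
lemma card_filter_image_eq_le {n : ℕ} (hn : 1 ≤ n) (e : Set V) (he : e.Nonempty) {m : ℕ}
    (hm : m ≤ e.ncard) (S : Set (Fin n)) :
    ((Finset.univ.filter fun φ : V ↪ Fin n => φ '' e = S).card : ℝ)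
      ≤ (Fintype.card V : ℝ) ^ Fintype.card V * ((n : ℝ) ^ Fintype.card V / (n : ℝ) ^ m) := by
  set v := Fintype.card V
  have hv : 1 ≤ v := Fintype.card_pos_iff.2 ⟨he.some⟩
  have hev : e.ncard ≤ v := by
    rw [show v = Nat.card V from Nat.card_eq_fintype_card.symm, ← Set.ncard_univ]
    exact Set.ncard_le_ncard (Set.subset_univ e)
  rcases (Finset.univ.filter fun φ : V ↪ Fin n => φ '' e = S).eq_empty_or_nonempty with h | ⟨ψ, hψ⟩
  · rw [h]
    simp only [Finset.card_empty, Nat.cast_zero]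
    positivity
  have hS : S.ncard = e.ncard := by
    rw [← (Finset.mem_filter.1 hψ).2, Set.ncard_image_of_injective _ ψ.injective]
  let F : {φ : V ↪ Fin n // φ '' e = S} → (e → S) × ((eᶜ : Set V) → Fin n) := fun φ =>
    (fun x => ⟨φ.1 x, φ.2.subset (Set.mem_image_of_mem _ x.2)⟩, fun x => φ.1 x)
  have hF : Function.Injective F := by
    intro φ φ' h
    ext x
    by_cases hx : x ∈ e
    · have := congrFun (congrArg Prod.fst h) ⟨x, hx⟩
      simpa [F] using congrArg (fun z : S => (z : Fin n).val) this
    · have := congrFun (congrArg Prod.snd h) ⟨x, hx⟩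
      simpa [F] using congrArg Fin.val this
  have hcard := Nat.card_le_card_of_injective F hF
  have hcompl : Nat.card (eᶜ : Set V) = v - e.ncard := by
    rw [Nat.card_coe_set_eq, Set.ncard_compl, Nat.card_eq_fintype_card]
  rw [Nat.card_prod, Nat.card_fun, Nat.card_fun, hcompl, Nat.card_coe_set_eq, Nat.card_coe_set_eq,
    hS, Nat.card_eq_fintype_card, Nat.card_eq_fintype_card, Fintype.card_fin,
    Fintype.card_subtype] at hcard
  have h2 : (Finset.univ.filter fun φ : V ↪ Fin n => φ '' e = S).card ≤ v ^ v * n ^ (v - m) := by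
    refine hcard.trans (Nat.mul_le_mul ?_ (Nat.pow_le_pow_right hn (by omega)))
    exact (Nat.pow_le_pow_left hev _).trans (Nat.pow_le_pow_right hv hev)
  have hn0 : (n : ℝ) ≠ 0 := by positivity
  rw [div_eq_mul_inv, ← pow_sub₀ _ hn0 (hm.trans hev)]
  exact_mod_cast h2

lemma card_terms_le (𝓔 : Finset (Set V)) (n : ℕ) :
    ((terms 𝓔 n).card : ℝ) ≤ 2 ^ 𝓔.card * (n : ℝ) ^ Fintype.card V := by
  have : (terms 𝓔 n).card ≤ 2 ^ 𝓔.card * n ^ Fintype.card V := by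
    rw [terms, Finset.card_product, mul_comm]
    refine Nat.mul_le_mul ?_ ?_
    · rw [← Finset.card_powerset]
      exact Finset.card_le_card (Finset.erase_subset _ _)
    · rw [Finset.card_univ, Fintype.card_embedding_eq, Fintype.card_fin]
      exact Nat.descFactorial_le_pow _ _
  exact_mod_cast this

-- Union bound over the edge of `t` and the edge of `u` whose images coincide; the factor `2 ^
-- 𝓔.card` accounts for the edge subset of `u`.
open Classical in
lemma sum_terms_not_disjoint_le {𝓔 : Finset (Set V)} {n : ℕ} (hn : 1 ≤ n)
    (h𝓔 : ∀ e ∈ 𝓔, e.Nonempty) {m : ℕ} (hm : ∀ e ∈ 𝓔, m ≤ e.ncard)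
    {t : (V ↪ Fin n) × Finset (Set V)} (ht : t ∈ terms 𝓔 n) :
    (∑ u ∈ terms 𝓔 n, if ¬Disjoint (termEdges t) (termEdges u) then (1 : ℝ) else 0)
      ≤ 2 ^ 𝓔.card * (𝓔.card * (𝓔.card * (Fintype.card V : ℝ) ^ Fintype.card V))
        * ((n : ℝ) ^ Fintype.card V / (n : ℝ) ^ m) := by
  set B := (Fintype.card V : ℝ) ^ Fintype.card V * ((n : ℝ) ^ Fintype.card V / (n : ℝ) ^ m)
  have hB : 0 ≤ B := by positivity
  have hle : ∀ u ∈ terms 𝓔 n, (if ¬Disjoint (termEdges t) (termEdges u) then (1 : ℝ) else 0)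
      ≤ ∑ e ∈ 𝓔, ∑ e' ∈ 𝓔, if u.1 '' e' = t.1 '' e then 1 else 0 := by
    intro u hu
    have hnn : ∀ e ∈ 𝓔, 0 ≤ ∑ e' ∈ 𝓔, (if u.1 '' e' = t.1 '' e then (1 : ℝ) else 0) :=
      fun e _ => Finset.sum_nonneg fun _ _ => by positivity
    split_ifs with h
    · exact Finset.sum_nonneg hnn
    · obtain ⟨x, hx, hx'⟩ := Finset.not_disjoint_iff.1 h
      obtain ⟨e, he, rfl⟩ := Finset.mem_image.1 hx
      obtain ⟨e', he', hee⟩ := Finset.mem_image.1 hx'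
      refine le_trans ?_ (Finset.single_le_sum hnn ((mem_terms.1 ht).2 he))
      refine le_trans ?_ (Finset.single_le_sum (fun _ _ => by positivity) ((mem_terms.1 hu).2 he'))
      rw [if_pos hee]
  refine (Finset.sum_le_sum hle).trans ?_
  rw [terms, Finset.sum_product, Finset.sum_comm]
  have hA : ∀ A ∈ 𝓔.powerset.erase ∅, (∑ φ : V ↪ Fin n, ∑ e ∈ 𝓔, ∑ e' ∈ 𝓔,
      if φ '' e' = t.1 '' e then (1 : ℝ) else 0) ≤ 𝓔.card * (𝓔.card * B) := by
    intro A _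
    rw [Finset.sum_comm]
    rw [← nsmul_eq_mul, ← Finset.sum_const]
    refine Finset.sum_le_sum fun e he => ?_
    rw [Finset.sum_comm, ← nsmul_eq_mul, ← Finset.sum_const]
    refine Finset.sum_le_sum fun e' he' => ?_
    have := card_filter_image_eq_le hn e' (h𝓔 e' he') (hm e' he') (t.1 '' e)
    simpa using this
  refine (Finset.sum_le_sum hA).trans ?_
  rw [Finset.sum_const, nsmul_eq_mul]
  have hc : ((𝓔.powerset.erase ∅).card : ℝ) ≤ 2 ^ 𝓔.card := by
    have := Finset.card_le_card (Finset.erase_subset ∅ 𝓔.powerset)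
    rw [Finset.card_powerset] at this
    exact_mod_cast this
  calc _ ≤ 2 ^ 𝓔.card * (𝓔.card * (𝓔.card * B)) := by gcongr
    _ = _ := by ring

open Classical in
lemma card_image_image_le {n : ℕ} (e : Set V) (s : Finset ((V ↪ Fin n) × Finset (Set V))) :
    ((s.image fun t => t.1 '' e).card : ℝ) ≤ (n : ℝ) ^ e.ncard := by
  have hsub : (s.image fun t => t.1 '' e) ⊆
      (Finset.univ : Finset (e → Fin n)).image fun f => Set.range f := by
    intro x hx
    obtain ⟨t, -, rfl⟩ := Finset.mem_image.1 hx
    exact Finset.mem_image.2 ⟨fun y => t.1 y, Finset.mem_univ _, by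
      ext z
      simp⟩
  have h := (Finset.card_le_card hsub).trans Finset.card_image_le
  rw [Finset.card_univ, Fintype.card_fun, Fintype.card_fin, ← Nat.card_eq_fintype_card,
    Nat.card_coe_set_eq] at h
  exact_mod_cast h

lemma le_card_embedding {n : ℕ} (hn : 2 * Fintype.card V ≤ n) :
    (1 / 2 : ℝ) ^ Fintype.card V * (n : ℝ) ^ Fintype.card V ≤ Fintype.card (V ↪ Fin n) := by
  rw [Fintype.card_embedding_eq, Fintype.card_fin, ← mul_pow]
  have h := Nat.pow_sub_le_descFactorial n (Fintype.card V)
  have h' : ((n + 1 - Fintype.card V : ℕ) : ℝ) ^ Fintype.card V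
      ≤ n.descFactorial (Fintype.card V) := by exact_mod_cast h
  -- Each factor of the descending factorial is at least `n + 1 - |V|`, which is at least `n / 2`.
  refine le_trans (pow_le_pow_left₀ (by positivity) ?_ _) h'
  have : (2 * Fintype.card V : ℝ) ≤ n := by exact_mod_cast hn
  rw [Nat.cast_sub (by omega)]
  push_cast
  linarith

end Embeddings

/-! ### From copies of the hypergraph to embeddings -/

section Copies

variable {α : Type*} (H : Hypergraph α)

/-- The edges of `H`, as sets in the type of vertices. -/
def subtypeEdges : Set (Set V(H)) := {e | Subtype.val '' e ∈ E(H)}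

/-- The image of `H` under an embedding of its vertices. -/
def embeddedCopy {β : Type*} (φ : V(H) ↪ β) : Hypergraph β where
  vertexSet := Set.range φ
  edgeSet := Set.image φ '' subtypeEdges H
  subset_vertexSet_of_mem_edgeSet' := by
    rintro _ ⟨e, -, rfl⟩
    exact Set.image_subset_range _ _

/-- The automorphisms of `H`. -/
def Automorphism : Type _ := {σ : V(H) ≃ V(H) // ∀ e, e ∈ subtypeEdges H ↔ σ '' e ∈ subtypeEdges H}

variable {H}

lemma embeddedCopy_isIsomorphic {β : Type*} (φ : V(H) ↪ β) :
    IsIsomorphic (embeddedCopy H φ) H := by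
  let g : V(H) ≃ V(embeddedCopy H φ) := Equiv.ofInjective φ φ.injective
  refine ⟨g.symm, fun s => ?_⟩
  obtain ⟨e, rfl⟩ : ∃ e, s = g '' e := ⟨g.symm '' s, (g.symm.symm_image_image s).symm⟩
  have h1 : Subtype.val '' (g '' e) = φ '' e := by
    rw [Set.image_image]
    rfl
  rw [g.symm_image_image, h1]
  change φ '' e ∈ Set.image φ '' subtypeEdges H ↔ e ∈ subtypeEdges H
  exact φ.injective.image_injective.mem_set_image

/-- The embedding of the vertices of `H` given by an automorphism and an isomorphism. -/
def embeddingOfIso {β : Type*} {F : Hypergraph β} (f : V(F) ≃ V(H)) (σ : V(H) ≃ V(H)) :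
    V(H) ↪ β :=
  (σ.trans f.symm).toEmbedding.trans (Function.Embedding.subtype _)

lemma embeddedCopy_embeddingOfIso {β : Type*} {F : Hypergraph β} {f : V(F) ≃ V(H)}
    (hf : ∀ s : Set V(F), (Subtype.val '' s : Set β) ∈ E(F) ↔
      (Subtype.val '' (f '' s) : Set α) ∈ E(H)) {σ : V(H) ≃ V(H)} :
    embeddedCopy H (embeddingOfIso f σ) = F ↔
      ∀ e, e ∈ subtypeEdges H ↔ σ '' e ∈ subtypeEdges H := by
  have himg : ∀ e : Set V(H), embeddingOfIso f σ '' e = Subtype.val '' (f.symm '' (σ '' e)) := by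
    intro e
    rw [Set.image_image, Set.image_image]
    rfl
  have hmem : ∀ e : Set V(H), embeddingOfIso f σ '' e ∈ E(F) ↔ σ '' e ∈ subtypeEdges H := by
    intro e
    rw [himg, hf]
    simp [Set.image_image, subtypeEdges]
  constructor
  · intro h e
    rw [← hmem]
    have hE : E(F) = Set.image (embeddingOfIso f σ) '' subtypeEdges H :=
      (congrArg Hypergraph.edgeSet h).symm
    rw [hE]
    exact ((embeddingOfIso f σ).injective.image_injective.mem_set_image).symm
  · intro h
    ext x
    · change x ∈ Set.range (embeddingOfIso f σ) ↔ _
      constructor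
      · rintro ⟨y, rfl⟩
        exact (f.symm (σ y)).2
      · intro hx
        exact ⟨σ.symm (f ⟨x, hx⟩), by simp [embeddingOfIso]⟩
    · change x ∈ Set.image (embeddingOfIso f σ) '' subtypeEdges H ↔ _
      constructor
      · rintro ⟨e, he, rfl⟩
        exact (hmem e).2 ((h e).1 he)
      · intro hx
        obtain ⟨s, rfl⟩ : ∃ s : Set V(F), Subtype.val '' s = x :=
          ⟨Subtype.val ⁻¹' x, by
            rw [Subtype.image_preimage_coe, Set.inter_eq_right.2 hx.subset_vertexSet]⟩
        have hs : embeddingOfIso f σ '' (σ.symm '' (f '' s)) = Subtype.val '' s := by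
          rw [himg]
          simp [Set.image_image]
        refine ⟨σ.symm '' (f '' s), ?_, hs⟩
        rw [h, ← hmem, hs]
        exact hx

-- Once an isomorphism `f` is fixed, every embedding with image `F` is `f.symm` precomposed with a
-- unique automorphism.
open Classical in
lemma card_fiber_embeddedCopy [Fintype V(H)] {n : ℕ} {F : Hypergraph (Fin n)}
    (hF : IsIsomorphic F H) :
    Nat.card {φ : V(H) ↪ Fin n // embeddedCopy H φ = F} = Nat.card (Automorphism H) := by
  obtain ⟨f, hf⟩ := hF
  symm
  refine Nat.card_congr (Equiv.ofBijective (fun σ : Automorphism H =>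
    (⟨embeddingOfIso f σ.1, (embeddedCopy_embeddingOfIso hf).2 σ.2⟩ :
      {φ : V(H) ↪ Fin n // embeddedCopy H φ = F})) ⟨?_, ?_⟩)
  · intro σ τ h
    refine Subtype.ext (Equiv.ext fun x => ?_)
    have := DFunLike.congr_fun (congrArg Subtype.val h) x
    exact f.symm.injective (Subtype.ext this)
  · rintro ⟨φ, rfl⟩
    let σ : V(H) ≃ V(H) := (Equiv.ofInjective φ φ.injective).trans f
    have hσ : embeddingOfIso f σ = φ := by
      refine DFunLike.ext _ _ fun x => ?_
      exact congrArg Subtype.val (f.symm_apply_apply (Equiv.ofInjective φ φ.injective x))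
    refine ⟨⟨σ, (embeddedCopy_embeddingOfIso hf).1 ?_⟩, Subtype.ext hσ⟩
    rw [hσ]

/-- The factor is the number of automorphisms, the common size of the fibres of `embeddedCopy`.
Absence of the empty edge keeps embedded copies inside the complete hypergraph. -/
lemma exists_mul_copyCount_eq [Fintype V(H)] (hempty : (∅ : Set α) ∉ E(H))
    (𝓔 : Finset (Set V(H))) (h𝓔 : ∀ e, e ∈ 𝓔 ↔ e ∈ subtypeEdges H) :
    ∃ k : ℝ, 0 < k ∧ ∀ (n : ℕ) (S : Set (Set (Fin n))),
      k * copyCount H n S = embeddingCount 𝓔 n S := by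
  classical
  have : Finite (Automorphism H) := Subtype.finite
  have : Nonempty (Automorphism H) := ⟨⟨Equiv.refl _, fun e => by simp⟩⟩
  refine ⟨Nat.card (Automorphism H), by exact_mod_cast Nat.card_pos, fun n S => ?_⟩
  set C := {H' : Hypergraph (Fin n) | IsSubhypergraph H' (completeHypergraph n) ∧
    IsIsomorphic H' H ∧ IsSubhypergraph H' (ofEdges S)} with hC
  have hinj : Function.Injective
      fun H' : Hypergraph (Fin n) => (H'.vertexSet, H'.edgeSet) := by
    intro F F' h
    exact Hypergraph.ext (congrArg Prod.fst h) (congrArg Prod.snd h)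
  have : Finite (Hypergraph (Fin n)) := Finite.of_injective _ hinj
  have hfin : C.Finite := Set.toFinite C
  set Φ := Finset.univ.filter fun φ : V(H) ↪ Fin n => ∀ e ∈ 𝓔, φ '' e ∈ S with hΦ
  have hcount : embeddingCount 𝓔 n S = Φ.card := by
    simp [embeddingCount, hΦ, Finset.prod_ite_zero]
  have hmaps : ∀ φ : V(H) ↪ Fin n, φ ∈ Φ ↔ embeddedCopy H φ ∈ C := by
    intro φ
    have hne : E(embeddedCopy H φ) ⊆ {e | e.Nonempty} := by
      rintro _ ⟨e, he, rfl⟩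
      refine Set.Nonempty.image _ (Set.nonempty_iff_ne_empty.2 ?_)
      rintro rfl
      exact hempty (by simpa [subtypeEdges] using he)
    rw [hΦ, Finset.mem_filter]
    constructor
    · rintro ⟨-, h⟩
      refine ⟨⟨Set.subset_univ _, hne⟩, embeddedCopy_isIsomorphic φ, Set.subset_univ _, ?_⟩
      rintro _ ⟨e, he, rfl⟩
      exact h e ((h𝓔 e).2 he)
    · rintro ⟨-, -, -, h⟩
      exact ⟨Finset.mem_univ _, fun e he => h ⟨e, (h𝓔 e).1 he, rfl⟩⟩
  have hfib := Finset.card_eq_sum_card_fiberwise (s := Φ) (t := hfin.toFinset)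
    (f := embeddedCopy H) fun φ hφ => hfin.mem_toFinset.2 ((hmaps φ).1 hφ)
  rw [Finset.sum_congr rfl (g := fun _ => Nat.card (Automorphism H))] at hfib
  · rw [Finset.sum_const, smul_eq_mul] at hfib
    rw [hcount, hfib, copyCount, Set.ncard_eq_toFinset_card _ hfin]
    push_cast
    ring
  · intro F hF
    have hF' : F ∈ C := hfin.mem_toFinset.1 hF
    rw [← card_fiber_embeddedCopy hF'.2.1, Nat.card_eq_fintype_card, Fintype.card_subtype]
    congr 1
    ext φ
    simp only [Finset.mem_filter, Finset.mem_univ, true_and, and_iff_right_iff_imp]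
    rintro rfl
    exact (hmaps φ).2 hF'

end Copies

/-! ### Central moments of a Bernoulli variable -/

section BernoulliMoments

lemma bernoulliMoment_zero (p : ℝ) : bernoulliMoment p 0 = 1 := by
  simp [bernoulliMoment]

lemma bernoulliMoment_one (p : ℝ) : bernoulliMoment p 1 = 0 := by
  simp only [bernoulliMoment]
  ring

lemma bernoulliMoment_two (p : ℝ) : bernoulliMoment p 2 = p * (1 - p) := by
  simp only [bernoulliMoment]
  ring

lemma abs_bernoulliMoment_le {p : ℝ} (h0 : 0 ≤ p) (h1 : p ≤ 1) {k : ℕ} (hk : 1 ≤ k) :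
    |bernoulliMoment p k| ≤ 1 - p := by
  obtain rfl | hk2 : k = 1 ∨ 2 ≤ k := by omega
  · rw [bernoulliMoment_one, abs_zero]
    linarith
  have hq : 0 ≤ 1 - p := by linarith
  have e1 : (1 - p) ^ k ≤ (1 - p) ^ 2 := pow_le_pow_of_le_one hq (by linarith) hk2
  have e2 : p ^ k ≤ p ^ 2 := pow_le_pow_of_le_one h0 h1 hk2
  calc |bernoulliMoment p k| ≤ |p * (1 - p) ^ k| + |(1 - p) * (-p) ^ k| := abs_add_le _ _
    _ = p * (1 - p) ^ k + (1 - p) * p ^ k := by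
        simp [abs_mul, abs_pow, abs_of_nonneg h0, abs_of_nonneg hq]
    _ ≤ p * (1 - p) ^ 2 + (1 - p) * p ^ 2 := by gcongr
    _ = p * (1 - p) := by ring
    _ ≤ 1 - p := mul_le_of_le_one_left hq h1

/-- The fourth cumulant is $pq(1-6pq)$ with $q=1-p$, and $pq\le 1/12$ in this range. -/
lemma le_bernoulliMoment_four_sub {p : ℝ} (h : 11 / 12 ≤ p) (h1 : p ≤ 1) :
    (1 - p) / 4 ≤ bernoulliMoment p 4 - 3 * bernoulliMoment p 2 ^ 2 := by
  have : bernoulliMoment p 4 - 3 * bernoulliMoment p 2 ^ 2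
      = (1 - p) * (p * (1 - 6 * (p * (1 - p)))) := by
    simp only [bernoulliMoment]
    ring
  rw [this]
  have hp : p * (1 - p) ≤ 1 / 12 := by nlinarith
  have : 1 / 4 ≤ p * (1 - 6 * (p * (1 - p))) := by nlinarith
  nlinarith

end BernoulliMoments

/-- The fourth moment of the standardization is invariant under affine changes. -/
lemma integral_standardize_pow_four {Ω : Type*} [MeasurableSpace Ω] {μ : Measure Ω}
    [IsProbabilityMeasure μ] {X W : Ω → ℝ} {k a : ℝ} (hk : 0 < k) (hX : AEMeasurable X μ)
    (hW : Integrable W μ) (hXW : ∀ ω, k * X ω = a + W ω) (hW0 : ∫ ω, W ω ∂μ = 0) :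
    ∫ ω, standardize X μ ω ^ 4 ∂μ = (∫ ω, W ω ^ 4 ∂μ) / (∫ ω, W ω ^ 2 ∂μ) ^ 2 := by
  have hX' : ∀ ω, X ω = (a + W ω) / k := fun ω => by
    rw [← hXW, mul_div_cancel_left₀ _ hk.ne']
  have hmean : ∫ ω, X ω ∂μ = a / k := by
    simp only [hX']
    rw [integral_div, integral_add (integrable_const _) hW, hW0]
    simp
  have hcent : ∀ ω, X ω - ∫ ω, X ω ∂μ = W ω / k := fun ω => by
    rw [hmean, hX']
    ring
  have hvar : variance X μ = (∫ ω, W ω ^ 2 ∂μ) / k ^ 2 := by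
    rw [variance_eq_integral hX]
    simp only [hcent, div_pow]
    rw [integral_div]
  have hnn : 0 ≤ variance X μ := variance_nonneg _ _
  have h4 : √(variance X μ) ^ 4 = ((∫ ω, W ω ^ 2 ∂μ) / k ^ 2) ^ 2 := by
    rw [← hvar, show 4 = 2 * 2 from rfl, pow_mul, Real.sq_sqrt hnn]
  simp only [standardize, hcent, div_pow _ _ 4, h4]
  rw [integral_div, integral_div]
  field_simp

/-- Applied with `x` equal to `n ^ |V|` and `y` to `n ^ m`. The condition `hqa` makes the error of
order `q ^ 2` at most half of the main term of `κ`. -/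
lemma fourthMoment_sub_three_bounds {κ v x y q b₁ b₂ a₁ a₂ : ℝ} (hq : 0 < q) (hx : 0 < x)
    (hy : 0 < y) (hb₂ : 0 < b₂) (ha₁ : 0 < a₁) (ha₂ : 0 < a₂) (hqa : q ≤ a₂ / (2 * a₁))
    (hv₁ : v ≤ b₁ * (q * (x ^ 2 / y))) (hv₂ : b₂ * (q * (x ^ 2 / y)) ≤ v)
    (hκ₁ : κ ≤ a₁ * (q * (x ^ 4 / y ^ 3)))
    (hκ₂ : a₂ * (q * (x ^ 4 / y ^ 3)) - a₁ * (q ^ 2 * (x ^ 4 / y ^ 3)) ≤ κ) :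
    a₂ / (2 * b₁ ^ 2) * (1 / (q * y)) ≤ (κ + 3 * v ^ 2) / v ^ 2 - 3 ∧
      (κ + 3 * v ^ 2) / v ^ 2 - 3 ≤ a₁ / b₂ ^ 2 * (1 / (q * y)) := by
  have hv : 0 < v := lt_of_lt_of_le (by positivity) hv₂
  have hb₁ : 0 < b₁ := pos_of_mul_pos_left (hv.trans_le hv₁) (by positivity)
  have heq : (κ + 3 * v ^ 2) / v ^ 2 - 3 = κ / v ^ 2 := by
    field_simp
    ring
  rw [heq]
  have hκ₃ : a₂ / 2 * (q * (x ^ 4 / y ^ 3)) ≤ κ := by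
    have h1 : a₁ * q ≤ a₂ / 2 := by
      calc a₁ * q ≤ a₁ * (a₂ / (2 * a₁)) := by gcongr
        _ = a₂ / 2 := by field_simp
    have h2 := mul_le_mul_of_nonneg_right h1 (show 0 ≤ q * (x ^ 4 / y ^ 3) by positivity)
    linarith
  have hκ : 0 ≤ κ := le_trans (by positivity) hκ₃
  constructor
  · calc a₂ / (2 * b₁ ^ 2) * (1 / (q * y))
        = (a₂ / 2 * (q * (x ^ 4 / y ^ 3))) / (b₁ * (q * (x ^ 2 / y))) ^ 2 := by
          field_simp
      _ ≤ κ / v ^ 2 := by gcongr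
  · calc κ / v ^ 2 ≤ (a₁ * (q * (x ^ 4 / y ^ 3))) / (b₂ * (q * (x ^ 2 / y))) ^ 2 := by gcongr
      _ = a₁ / b₂ ^ 2 * (1 / (q * y)) := by
          field_simp

/-! ### Orders of magnitude of the variance and the fourth cumulant -/

section MainBounds

variable {V : Type*} {𝓔 : Finset (Set V)} {n : ℕ} {p : ℝ}

lemma termCoeff_nonneg (h0 : 0 ≤ p) (t : (V ↪ Fin n) × Finset (Set V)) : 0 ≤ termCoeff p 𝓔 t :=
  pow_nonneg h0 _

lemma termCoeff_le_one (h0 : 0 ≤ p) (h1 : p ≤ 1) (t : (V ↪ Fin n) × Finset (Set V)) :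
    termCoeff p 𝓔 t ≤ 1 :=
  pow_le_one₀ h0 h1

lemma half_pow_le_termCoeff (h : 1 / 2 ≤ p) (t : (V ↪ Fin n) × Finset (Set V)) :
    (1 / 2) ^ 𝓔.card ≤ termCoeff p 𝓔 t :=
  (pow_le_pow_of_le_one (by norm_num) (by norm_num) (Nat.sub_le _ _)).trans
    (pow_le_pow_left₀ (by norm_num) h _)

variable [Fintype V]

lemma termEdges_nonempty {t : (V ↪ Fin n) × Finset (Set V)} (ht : t ∈ terms 𝓔 n) :
    (termEdges t).Nonempty :=
  (Finset.nonempty_iff_ne_empty.2 (mem_terms.1 ht).1).image _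

lemma nonempty_of_mem_termEdges (h𝓔 : ∀ e ∈ 𝓔, e.Nonempty)
    {t : (V ↪ Fin n) × Finset (Set V)} (ht : t ∈ terms 𝓔 n) {x : Set (Fin n)}
    (hx : x ∈ termEdges t) : x.Nonempty := by
  obtain ⟨e, he, rfl⟩ := Finset.mem_image.1 hx
  exact (h𝓔 e ((mem_terms.1 ht).2 he)).image _

open Classical in
lemma exists_sum_bounds (h𝓔 : ∀ e ∈ 𝓔, e.Nonempty) {e₀ : Set V} (he₀ : e₀ ∈ 𝓔)
    (hmin : ∀ e ∈ 𝓔, e₀.ncard ≤ e.ncard) :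
    ∃ b₁ b₂ a₁ a₂ : ℝ, 0 < b₁ ∧ 0 < b₂ ∧ 0 < a₁ ∧ 0 < a₂ ∧
      ∀ n : ℕ, 1 ≤ n → 2 * Fintype.card V ≤ n → ∀ p : ℝ, 11 / 12 ≤ p → p < 1 →
        let x := (n : ℝ) ^ Fintype.card V
        let y := (n : ℝ) ^ e₀.ncard
        let v := secondMomentSum (bernoulliMoment p) (terms 𝓔 n) (termCoeff p 𝓔) termEdges
        let κ := fourthCumulantSum (bernoulliMoment p) (terms 𝓔 n) (termCoeff p 𝓔) termEdges
        v ≤ b₁ * ((1 - p) * (x ^ 2 / y)) ∧ b₂ * ((1 - p) * (x ^ 2 / y)) ≤ v ∧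
        κ ≤ a₁ * ((1 - p) * (x ^ 4 / y ^ 3)) ∧
        a₂ * ((1 - p) * (x ^ 4 / y ^ 3)) - a₁ * ((1 - p) ^ 2 * (x ^ 4 / y ^ 3)) ≤ κ := by
  have hcE : 0 < 𝓔.card := Finset.card_pos.2 ⟨_, he₀⟩
  have hcV : 0 < Fintype.card V := Fintype.card_pos_iff.2 ⟨(h𝓔 e₀ he₀).some⟩
  set B : ℝ := 2 ^ 𝓔.card * (𝓔.card * (𝓔.card * (Fintype.card V : ℝ) ^ Fintype.card V)) with hB
  have hBpos : 0 < B := by positivity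
  set δ : ℝ := (1 / 2) ^ 𝓔.card with hδ
  set η : ℝ := (1 / 2) ^ Fintype.card V with hη
  -- Here `B` bounds the neighbours of a term in units of `x / y`, `δ` is a lower bound for the
  -- coefficients, and `η * x` for the number of embeddings.
  refine ⟨2 ^ 𝓔.card * B, 1 / 2 * δ ^ 2 * η ^ 2, 144 * 2 ^ 𝓔.card * B ^ 3, 1 / 4 * δ ^ 4 * η ^ 4,
    by positivity, by positivity, by positivity, by positivity, ?_⟩
  intro n hn hn2 p hp hp1 x y v κ
  have hx : 0 < x := by positivity
  have hy : 0 < y := by positivity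
  have hp0 : 0 ≤ p := by linarith
  have hq : 0 ≤ 1 - p := by linarith
  have hm0 := bernoulliMoment_zero p
  have hm1 := bernoulliMoment_one p
  have hm : ∀ k, 1 ≤ k → k ≤ 4 → |bernoulliMoment p k| ≤ 1 - p :=
    fun k hk _ => abs_bernoulliMoment_le hp0 hp1.le hk
  have hm4 := le_bernoulliMoment_four_sub hp hp1.le
  have hm4' : 0 ≤ bernoulliMoment p 4 - 3 * bernoulliMoment p 2 ^ 2 :=
    le_trans (by positivity) hm4
  have hm2 : 1 / 2 * (1 - p) ≤ bernoulliMoment p 2 := by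
    rw [bernoulliMoment_two]
    gcongr
    linarith
  have hm2' : 0 ≤ bernoulliMoment p 2 := le_trans (by positivity) hm2
  have hc0 : ∀ t ∈ terms 𝓔 n, 0 ≤ termCoeff p 𝓔 t := fun t _ => termCoeff_nonneg hp0 t
  have hc1 : ∀ t ∈ terms 𝓔 n, termCoeff p 𝓔 t ≤ 1 := fun t _ => termCoeff_le_one hp0 hp1.le t
  have hG : ∀ t ∈ terms 𝓔 n, (termEdges t).Nonempty := fun t ht => termEdges_nonempty ht
  have hK : ∀ t ∈ terms 𝓔 n, (∑ u ∈ terms 𝓔 n,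
      if ¬Disjoint (termEdges t) (termEdges u) then (1 : ℝ) else 0) ≤ B * (x / y) :=
    fun t ht => sum_terms_not_disjoint_le hn h𝓔 hmin ht
  have hs : ((terms 𝓔 n).card : ℝ) ≤ 2 ^ 𝓔.card * x := card_terms_le 𝓔 n
  -- The dominant terms: a single edge of smallest size.
  set s' : Finset ((V ↪ Fin n) × Finset (Set V)) := Finset.univ ×ˢ {{e₀}} with hs'
  have hsub : s' ⊆ terms 𝓔 n := by
    intro t ht
    obtain ⟨-, h⟩ := Finset.mem_product.1 ht
    rw [mem_terms, Finset.mem_singleton.1 h]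
    simp [he₀]
  have hg : ∀ t ∈ s', termEdges t = {t.1 '' e₀} := by
    intro t ht
    obtain ⟨-, h⟩ := Finset.mem_product.1 ht
    rw [termEdges, Finset.mem_singleton.1 h, Finset.image_singleton]
  have hcδ : ∀ t ∈ s', δ ≤ termCoeff p 𝓔 t :=
    fun t _ => half_pow_le_termCoeff (by linarith) t
  have hcard := card_image_image_le e₀ s'
  have hs'card : η * x ≤ s'.card := by
    rw [hs', Finset.card_product, Finset.card_singleton, mul_one, Finset.card_univ]
    exact le_card_embedding hn2
  have hsK : ((terms 𝓔 n).card : ℝ) * (B * (x / y)) ^ 3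
      ≤ 2 ^ 𝓔.card * B ^ 3 * (x ^ 4 / y ^ 3) := by
    calc _ ≤ 2 ^ 𝓔.card * x * (B * (x / y)) ^ 3 := by gcongr
      _ = _ := by field_simp
  refine ⟨?_, ?_, ?_, ?_⟩
  · refine (secondMomentSum_le hm0 hm1 (by linarith) hm hc0 hc1 hG hK).trans ?_
    calc (1 - p) * ((terms 𝓔 n).card * (B * (x / y)))
        ≤ (1 - p) * (2 ^ 𝓔.card * x * (B * (x / y))) := by gcongr
      _ = _ := by field_simp
  · refine le_trans ?_ (le_secondMomentSum hm0 hm1 hm2' hc0 hsub hg (by positivity) hcδ hcard)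
    calc 1 / 2 * δ ^ 2 * η ^ 2 * ((1 - p) * (x ^ 2 / y))
        = 1 / 2 * (1 - p) * δ ^ 2 * ((η * x) ^ 2 / y) := by ring
      _ ≤ _ := by gcongr
  · refine (fourthCumulantSum_le hm0 hm1 (by linarith) hm hc0 hc1 hG hK).trans ?_
    calc _ ≤ 144 * (1 - p) * (2 ^ 𝓔.card * B ^ 3 * (x ^ 4 / y ^ 3)) := by gcongr
      _ = _ := by ring
  · refine le_trans (sub_le_sub ?_ ?_) (le_fourthCumulantSum hm0 hm1 (by linarith) hm hm4' hc0 hc1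
      hG hK hsub hg (by positivity) hcδ hcard)
    · calc 1 / 4 * δ ^ 4 * η ^ 4 * ((1 - p) * (x ^ 4 / y ^ 3))
          = (1 - p) / 4 * δ ^ 4 * ((η * x) ^ 4 / y ^ 3) := by ring
        _ ≤ _ := by gcongr
    · calc _ ≤ 144 * (1 - p) ^ 2 * (2 ^ 𝓔.card * B ^ 3 * (x ^ 4 / y ^ 3)) := by gcongr
        _ = _ := by ring

end MainBounds

open Classical in
lemma fourthMoment_eq {α : Type*} {H : Hypergraph α} [Fintype V(H)]
    (hempty : (∅ : Set α) ∉ E(H)) (𝓔 : Finset (Set V(H)))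
    (h𝓔 : ∀ e, e ∈ 𝓔 ↔ e ∈ subtypeEdges H) (h𝓔' : ∀ e ∈ 𝓔, e.Nonempty) (n : ℕ)
    (p : unitInterval) :
    fourthMoment H n p =
      (fourthCumulantSum (bernoulliMoment p) (terms 𝓔 n) (termCoeff p 𝓔) termEdges
        + 3 * secondMomentSum (bernoulliMoment p) (terms 𝓔 n) (termCoeff p 𝓔) termEdges ^ 2)
      / secondMomentSum (bernoulliMoment p) (terms 𝓔 n) (termCoeff p 𝓔) termEdges ^ 2 := by
  obtain ⟨k, hk, hcount⟩ := exists_mul_copyCount_eq hempty 𝓔 h𝓔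
  have hu : ∀ t ∈ terms 𝓔 n, ∀ e ∈ termEdges t, e ∈ E(completeHypergraph n) :=
    fun t ht e he => nonempty_of_mem_termEdges h𝓔' ht he
  rw [fourthMoment, edgeLaw, integral_standardize_pow_four (k := k)
    (W := centeredPoly (p : ℝ) (terms 𝓔 n) (termCoeff p 𝓔) termEdges) hk
    (Measurable.of_discrete.aemeasurable) Integrable.of_finite
    (fun S => (hcount n S).trans (embeddingCount_eq 𝓔 n p S))
    (integral_centeredPoly p _ (fun t ht => termEdges_nonempty ht) hu),
    integral_centeredPoly_sq p _ hu, integral_centeredPoly_pow_four p _ hu]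

end RandomHypergraph

open RandomHypergraph in
theorem theorem5p4 {α : Type*} (H : Hypergraph α) (hfin : (Hypergraph.vertexSet H).Finite)
    (hne : (Hypergraph.edgeSet H).Nonempty) (hempty : (∅ : Set α) ∉ Hypergraph.edgeSet H) :
    ∃ ε : ℝ, 0 < ε ∧ ∃ C₁ C₂ : ℝ, 0 < C₁ ∧ 0 < C₂ ∧ ∃ n₀ : ℕ, ∀ n : ℕ, n₀ ≤ n →
      ∀ p : unitInterval, 0 < (p : ℝ) → (p : ℝ) < 1 → 1 - ε < (p : ℝ) →
        C₁ * (1 / ((1 - (p : ℝ)) * (n : ℝ) ^ RandomHypergraph.minEdgeSize H))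
            ≤ RandomHypergraph.fourthMoment H n p - 3 ∧
        RandomHypergraph.fourthMoment H n p - 3
            ≤ C₂ * (1 / ((1 - (p : ℝ)) * (n : ℝ) ^ RandomHypergraph.minEdgeSize H)) := by
  classical
  have : Fintype V(H) := hfin.fintype
  set 𝓔 : Finset (Set V(H)) := Finset.univ.filter fun e => e ∈ subtypeEdges H with h𝓔def
  have h𝓔 : ∀ e, e ∈ 𝓔 ↔ e ∈ subtypeEdges H := fun e => by simp [h𝓔def]
  have h𝓔' : ∀ e ∈ 𝓔, e.Nonempty := by
    intro e he
    refine Set.nonempty_iff_ne_empty.2 ?_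
    rintro rfl
    exact hempty (by simpa [subtypeEdges] using (h𝓔 _).1 he)
  -- The infimum is attained because there is an edge, so the default value of `sInf` plays no role.
  obtain ⟨f, hf, hfm⟩ : minEdgeSize H ∈ Set.ncard '' E(H) := Nat.sInf_mem (hne.image _)
  have hval : Subtype.val '' (Subtype.val ⁻¹' f : Set V(H)) = f := by
    rw [Subtype.image_preimage_coe, Set.inter_eq_right.2 hf.subset_vertexSet]
  have hncard : ∀ e : Set V(H), (Subtype.val '' e : Set α).ncard = e.ncard :=
    fun e => Set.ncard_image_of_injective _ Subtype.val_injective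
  have he₀ : (Subtype.val ⁻¹' f : Set V(H)) ∈ 𝓔 := (h𝓔 _).2 (by
    change Subtype.val '' _ ∈ E(H)
    rwa [hval])
  have hm : (Subtype.val ⁻¹' f : Set V(H)).ncard = minEdgeSize H := by
    rw [← hncard, hval, hfm]
  have hmin : ∀ e ∈ 𝓔, (Subtype.val ⁻¹' f : Set V(H)).ncard ≤ e.ncard := by
    intro e he
    rw [hm, ← hncard]
    exact Nat.sInf_le ⟨_, (h𝓔 e).1 he, rfl⟩
  obtain ⟨b₁, b₂, a₁, a₂, hb₁, hb₂, ha₁, ha₂, hbounds⟩ := exists_sum_bounds h𝓔' he₀ hmin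
  -- The bound `1 / 12` ensures `11 / 12 ≤ p`, the other one absorbs the `q ^ 2` error, and `n₀`
  -- makes embeddings plentiful.
  refine ⟨min (1 / 12) (a₂ / (2 * a₁)), by positivity, a₂ / (2 * b₁ ^ 2), a₁ / b₂ ^ 2,
    by positivity, by positivity, max 1 (2 * Fintype.card V(H)), ?_⟩
  intro n hn p _ hp1 hpε
  have hn1 : 1 ≤ n := (le_max_left _ _).trans hn
  have hε₁ := min_le_left (1 / 12) (a₂ / (2 * a₁))
  have hε₂ := min_le_right (1 / 12) (a₂ / (2 * a₁))
  obtain ⟨h1, h2, h3, h4⟩ := hbounds n hn1 ((le_max_right _ _).trans hn) p (by linarith) hp1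
  rw [hm] at h1 h2 h3 h4
  rw [fourthMoment_eq hempty 𝓔 h𝓔 h𝓔' n p]
  exact fourthMoment_sub_three_bounds (by linarith) (by positivity) (by positivity) hb₂ ha₁ ha₂
    (by linarith) h1 h2 h3 h4
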